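/- Let $\alpha\in[0,1)$, $\beta\in\mathbb R$, $\Delta a_n=a_{n+1}-a_n$, $r_n=n^\alpha$, and consider $$(1)\ \ \Delta(n^\alpha\Delta y_n)=\frac{(-1)^n}{(n+1)^{\beta}}\,y_{n+1},\qquad (2)\ \ \Delta(n^\alpha\Delta z_n)=0,\qquad n\ge 1,$$ so that (1) reads $\Delta(r_n\Delta y_n)=\sigma_{n+1}y_{n+1}$ with $\sigma_n=(-1)^{n+1}n^{-\beta}$. Call a pair $(u,v)$ of real solutions of (2) a principal pair if $r_n(v_{n+1}u_n-u_{n+1}v_n)=1$ for $n\ge1$, $u_n/v_n\to0$, and there is $n_1\ge 1$ such that $u_n,v_n>0$ for $n\ge n_1$, $\sum_{n\ge n_1}\frac1{r_nu_nu_{n+1}}=\infty$ and $\sum_{n\ge n_1}\frac1{r_nv_nv_{n+1}}<\infty$. The Hartman–Wintner problem is solvable if (1) has two linearly independent (complex) solutions $\tilde u,\tilde v$ such that, as $n\to\infty$, $\tilde u_n/u_n\to1$, $\tilde v_n/v_n\to1$, $$\frac{\tilde u_{n+1}}{\tilde u_n}=\frac{u_{n+1}}{u_n}+o\Big(\frac1{r_nu_nv_n}\Big),\qquad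 \frac{\tilde v_{n+1}}{\tilde v_n}=\frac{v_{n+1}}{v_n}+o\Big(\frac1{r_nu_nv_n}\Big).$$ The narrow Hartman–Wintner problem is solvable if such $\tilde u,\tilde v$ exist with, in addition, $\sum_n r_nu_nv_{n+1}\big|\frac{\tilde u_{n+1}}{u_{n+1}}-\frac{\tilde u_n}{u_n}\big|^2<\infty$. Put $$J=\sum_{n\ge1}\sigma_nu_nv_n,\quad B=\sum_{n\ge1}|\sigma_nu_nv_n|^2,\quad C_n=\frac{v_n}{u_n}\sum_{k\ge n}\sigma_ku_k^2,\quad P=\sum_{n\ge1}\operatorname{Re}(\sigma_n\overline{C_n})u_nv_n,$$ where convergence of a series means convergence (possibly conditional) of its partial sums. The pair $u_n=1$, $v_n=\sum_{k=1}^{n-1}k^{-\alpha}$ is a principal pair. Moreover, for every principal pair $(u,v)$ and every $\beta\in\mathbb R$: (a) the Hartman–Wintner problem is solvable if and only if $\alpha+\beta>1$ and $\beta>0$; (b) if $\beta\le\frac32-\alpha$, then $B$ diverges; (c) if $1-\alpha<\beta\le\frac32-\alpha$, then the narrow Hartman–Wintner problem is solvable, $J$ and $\sum_n\sigma_nu_n^2$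 converge (so that $C_n$ is well defined), but $P$ diverges. Hence the claim "the narrow Hartman–Wintner problem is solvable if and only if both $J$ and $P$ converge" is false for these equations. -/

import Mathlib

open Filter Topology Asymptotics

noncomputable section

namespace HartmanWintner

/-- The series `∑_{n ≥ n₀} a n` converges, at least conditionally: its partial sums,
taken in the natural order, have a (finite) limit. -/
def SeriesConverges {E : Type*} [AddCommMonoid E] [TopologicalSpace E]
    (n₀ : ℕ) (a : ℕ → E) : Prop :=
  ∃ s : E, Tendsto (fun N : ℕ => ∑ k ∈ Finset.Ico n₀ N, a k) atTop (𝓝 s)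

/-- The sequence `y`, regarded for indices `n ≥ n₀`, solves
`Δ(r_n Δ y_n) = c_{n+1} y_{n+1}` for all `n ≥ n₀`, where `Δ a_n = a_{n+1} - a_n`. -/
def IsSolution {𝕜 : Type*} [Ring 𝕜] (n₀ : ℕ) (r c y : ℕ → 𝕜) : Prop :=
  ∀ n ≥ n₀, r (n + 1) * (y (n + 2) - y (n + 1)) - r n * (y (n + 1) - y n)
    = c (n + 1) * y (n + 1)

/-- `u` is a principal and `v` a non-principal solution of the unperturbed equation
`Δ(r_n Δ z_n) = q_{n+1} z_{n+1}`, `n ≥ n₀`, normalized by their Casoratian. -/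
structure IsPrincipalPair (n₀ : ℕ) (r q u v : ℕ → ℝ) : Prop where
  solution_u : IsSolution n₀ r q u
  solution_v : IsSolution n₀ r q v
  casoratian : ∀ n ≥ n₀, r n * (v (n + 1) * u n - u (n + 1) * v n) = 1
  ratio : Tendsto (fun n => u n / v n) atTop (𝓝 0)
  eventually_pos : ∃ n₁ ≥ n₀, (∀ n ≥ n₁, 0 < u n ∧ 0 < v n) ∧
    ¬ SeriesConverges n₁ (fun n => 1 / (r n * u n * u (n + 1))) ∧
    SeriesConverges n₁ (fun n => 1 / (r n * v n * v (n + 1)))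

/-- `(y, w)` is a fundamental system of solutions of the perturbed equation
`Δ(r_n Δ y_n) = (q_{n+1} + σ_{n+1}) y_{n+1}`, `n ≥ n₀`: two solutions that are linearly
independent as sequences indexed by `n ≥ n₀`. -/
def IsFSS (n₀ : ℕ) (r q : ℕ → ℝ) (σ y w : ℕ → ℂ) : Prop :=
  IsSolution n₀ (fun n => (r n : ℂ)) (fun n => (q n : ℂ) + σ n) y ∧
  IsSolution n₀ (fun n => (r n : ℂ)) (fun n => (q n : ℂ) + σ n) w ∧
  LinearIndependent ℂ ![fun k : ℕ => y (n₀ + k), fun k : ℕ => w (n₀ + k)]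

/-- The asymptotic requirements of the Hartman–Wintner problem on `(y, w)`,
relative to the pair `(u, v)`. -/
structure HasAsymptotics (r u v : ℕ → ℝ) (y w : ℕ → ℂ) : Prop where
  tendsto_u : Tendsto (fun n => y n / (u n : ℂ)) atTop (𝓝 1)
  tendsto_v : Tendsto (fun n => w n / (v n : ℂ)) atTop (𝓝 1)
  ratio_u : (fun n => y (n + 1) / y n - (u (n + 1) : ℂ) / (u n : ℂ))
    =o[atTop] (fun n => 1 / (r n * u n * v n))
  ratio_v : (fun n => w (n + 1) / w n - (v (n + 1) : ℂ) / (v n : ℂ))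
    =o[atTop] (fun n => 1 / (r n * u n * v n))

/-- Solvability of the Hartman–Wintner problem. -/
def Solvable (n₀ : ℕ) (r q : ℕ → ℝ) (σ : ℕ → ℂ) (u v : ℕ → ℝ) : Prop :=
  ∃ y w : ℕ → ℂ, IsFSS n₀ r q σ y w ∧ HasAsymptotics r u v y w

/-- Solvability of the narrow Hartman–Wintner problem. -/
def NarrowSolvable (n₀ : ℕ) (r q : ℕ → ℝ) (σ : ℕ → ℂ) (u v : ℕ → ℝ) : Prop :=
  ∃ y w : ℕ → ℂ, IsFSS n₀ r q σ y w ∧ HasAsymptotics r u v y w ∧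
    SeriesConverges n₀ (fun n => r n * u n * v (n + 1) *
      ‖y (n + 1) / (u (n + 1) : ℂ) - y n / (u n : ℂ)‖ ^ 2)

/-- General term of the series `∑ σ_n u_n²`. -/
def sigmaTerm (σ : ℕ → ℂ) (u : ℕ → ℝ) (n : ℕ) : ℂ := σ n * (u n : ℂ) ^ 2

/-- General term of the series `J = ∑ σ_n u_n v_n`. -/
def JTerm (σ : ℕ → ℂ) (u v : ℕ → ℝ) (n : ℕ) : ℂ := σ n * (u n : ℂ) * (v n : ℂ)

/-- `C_n = (v_n / u_n) ∑_{k ≥ n} σ_k u_k²`; meaningful when the series `∑ σ_k u_k²`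
converges (at least conditionally). -/
def C (σ : ℕ → ℂ) (u v : ℕ → ℝ) (n : ℕ) : ℂ :=
  (v n : ℂ) / (u n : ℂ) *
    limUnder atTop (fun N : ℕ => ∑ k ∈ Finset.Ico n N, sigmaTerm σ u k)

/-- General term of the series `P = ∑ Re(σ_n \overline{C_n}) u_n v_n`. -/
def PTerm (σ : ℕ → ℂ) (u v : ℕ → ℝ) (n : ℕ) : ℝ :=
  (σ n * (starRingEnd ℂ) (C σ u v n)).re * u n * v n

/-- General term of the series `B = ∑ |σ_n u_n v_n|²`. -/
def BTerm (σ : ℕ → ℂ) (u v : ℕ → ℝ) (n : ℕ) : ℝ := ‖JTerm σ u v n‖ ^ 2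

/-- The coefficient `r_n = n^α`. -/
def rPow (α : ℝ) (n : ℕ) : ℝ := (n : ℝ) ^ α

/-- The oscillating perturbation, `σ_{n+1} = (-1)^n (n+1)^{-β}`,
that is `σ_n = (-1)^(n+1) n^{-β}` for `n ≥ 1`. -/
def sigmaOsc (β : ℝ) (n : ℕ) : ℂ := (((-1 : ℝ) ^ (n + 1) * (n : ℝ) ^ (-β) : ℝ) : ℂ)

end HartmanWintner

end

noncomputable section

namespace HartmanWintner

/-! Solutions of the unperturbed equation are affine in V_n = `powerSum α n`, and the principal-pair
conditions leave only u = a, v = (V + b)/a with a > 0 (`IsPrincipalPair.exists_eq`). Since V_n has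
order n^(1-α), the product r_n u_n v_n has order n, so the asymptotic requirements read o(1/n).

Let S_n be the tail of ∑ σ_k; by the Leibniz test it has the sign of σ_n and |S_n| ≤ n^(-β). For α +
β > 1, setting p_n = r_n Δy_n + S_{n+1} y_n turns the equation into a first order system whose
coefficients, after weighting p by n^β, are bounded by the summable n^(-(α+β)). A contraction
argument gives y → 1 and Δy = O(n^(-(α+β))) (`exists_solution_tendsto_one`); reduction of order
supplies the second solution, and `narrowSolvable_of_one_lt` checks all requirements. Conversely,
the ratio condition on the first solution alone forces σ_n = o(n^(α-1)), that is, α + β > 1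
(`one_lt_of_solvable`).

If β ≤ 3/2 - α, then (n^(-β) V_n)² is at least of order 1/n, so B diverges. In P the oscillation
cancels: σ_n S_n ≥ 0, so P has nonnegative terms, comparable in consecutive pairs with 1/n, and
diverges too, while J converges by summation by parts. -/

/-! ### First order systems with summable coefficients -/

/-- A Volterra-type equation `x n = g + ∑_{k ≥ n} K n k (x k)` whose kernel is Lipschitz with
constants of total mass less than one has a bounded solution. -/
theorem exists_bounded_tail_fixed_point {E : Type*} [NormedAddCommGroup E] [CompleteSpace E]
    (g : E) (K : ℕ → ℕ → E → E) (e : ℕ → ℝ) (he₀ : ∀ k, 0 ≤ e k) (he : Summable e)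
    (hlt : ∑' k, e k < 1) (hK₀ : ∀ n k, K n k 0 = 0)
    (hK : ∀ n k, n ≤ k → ∀ x y, ‖K n k x - K n k y‖ ≤ e k * ‖x - y‖) :
    ∃ (x : ℕ → E) (M : ℝ), (∀ n, ‖x n‖ ≤ M) ∧
      ∀ n, x n = g + ∑' j, K n (j + n) (x (j + n)) := by
  have hsum_e : ∀ n, Summable fun j => e (j + n) := fun n => (summable_nat_add_iff n).2 he
  have htail : ∀ n, ∑' j, e (j + n) ≤ ∑' k, e k := fun n =>
    (hsum_e n).tsum_le_tsum_of_inj (fun j => j + n) (add_left_injective n)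
      (fun c _ => he₀ c) (fun i => le_rfl) he
  have hbd : ∀ (x y : ℕ → E) (M : ℝ), (∀ n, ‖x n - y n‖ ≤ M) → ∀ n j,
      ‖K n (j + n) (x (j + n)) - K n (j + n) (y (j + n))‖ ≤ e (j + n) * M := fun x y M hM n j =>
    (hK n _ (Nat.le_add_left n j) _ _).trans (mul_le_mul_of_nonneg_left (hM _) (he₀ _))
  have hbd0 : ∀ (x : ℕ → E) (M : ℝ), (∀ n, ‖x n‖ ≤ M) → ∀ n j,
      ‖K n (j + n) (x (j + n))‖ ≤ e (j + n) * M := fun x M hM n j => by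
    simpa [hK₀] using hbd x 0 M (by simpa using hM) n j
  have hsum : ∀ (x : ℕ → E) (M : ℝ), (∀ n, ‖x n‖ ≤ M) → ∀ n,
      Summable fun j => K n (j + n) (x (j + n)) := fun x M hM n =>
    Summable.of_norm_bounded ((hsum_e n).mul_right M) (hbd0 x M hM n)
  -- Banach's fixed point theorem is applied on bounded sequences with the sup norm; `hK₀` together
  -- with the Lipschitz bound makes the tail sums converge and stay bounded.
  let T : BoundedContinuousFunction ℕ E → BoundedContinuousFunction ℕ E := fun x =>
    BoundedContinuousFunction.ofNormedAddCommGroupDiscrete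
      (fun n => g + ∑' j, K n (j + n) (x (j + n))) (‖g‖ + (∑' k, e k) * ‖x‖) (fun n => by
        refine (norm_add_le _ _).trans (add_le_add_right ?_ _)
        refine (tsum_of_norm_bounded (((hsum_e n).mul_right ‖x‖).hasSum)
          (hbd0 x ‖x‖ x.norm_coe_le_norm n)).trans ?_
        rw [tsum_mul_right]
        exact mul_le_mul_of_nonneg_right (htail n) (norm_nonneg _))
  have hT : ContractingWith ⟨∑' k, e k, tsum_nonneg he₀⟩ T := by
    refine ⟨by exact_mod_cast hlt, LipschitzWith.of_dist_le_mul fun x y => ?_⟩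
    refine (BoundedContinuousFunction.dist_le
      (mul_nonneg (tsum_nonneg he₀) dist_nonneg)).2 fun n => ?_
    have hxy : ∀ k, ‖x k - y k‖ ≤ dist x y := fun k => by
      rw [← dist_eq_norm]; exact BoundedContinuousFunction.dist_coe_le_dist k
    have hs := (hsum x ‖x‖ x.norm_coe_le_norm n).tsum_sub (hsum y ‖y‖ y.norm_coe_le_norm n)
    change dist (g + ∑' j, K n (j + n) (x (j + n))) (g + ∑' j, K n (j + n) (y (j + n))) ≤ _
    rw [dist_add_left, dist_eq_norm, ← hs]
    refine (tsum_of_norm_bounded (((hsum_e n).mul_right (dist x y)).hasSum)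
      (hbd x y _ hxy n)).trans ?_
    rw [tsum_mul_right]
    exact mul_le_mul_of_nonneg_right (htail n) dist_nonneg
  obtain ⟨x, hx, -⟩ := hT.exists_fixedPoint 0 (edist_ne_top _ _)
  refine ⟨x, ‖x‖, x.norm_coe_le_norm, fun n => ?_⟩
  exact (congrArg (fun f : BoundedContinuousFunction ℕ E => f n) hx).symm

theorem tsum_tail_sub {a : ℕ → ℝ} (n : ℕ) (ha : Summable fun j => a (j + n)) :
    ∑' j, a (j + n) - ∑' j, a (j + (n + 1)) = a n := by
  rw [ha.tsum_eq_zero_add]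
  simp only [zero_add, add_assoc, add_comm 1 n, add_sub_cancel_right]

/-- Existence of a bounded solution tending to `1` for a weighted first order system with
summable coefficients. -/
theorem exists_solution_of_small (s t ρ ω e : ℕ → ℝ) (hω : ∀ k, 0 < ω k) (hmono : Monotone ω)
    (he : Summable e) (hlt : ∑' k, e k < 1 / 2) (hs : ∀ k, |s k| ≤ e k)
    (hρ : ∀ k, |ρ k| ≤ ω k * e k) (ht : ∀ k, |t k| * ω k ≤ e k) :
    ∃ (y p : ℕ → ℝ) (M : ℝ), (∀ k, y (k + 1) = y k - s k * y k + ρ k * p k) ∧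
      (∀ k, p (k + 1) = p k + s k * p k - t k * y k) ∧
      Tendsto y atTop (𝓝 1) ∧ ∀ k, |p k| * ω k ≤ M := by
  have he₀ : ∀ k, 0 ≤ e k := fun k => (abs_nonneg _).trans (hs k)
  have hρω : ∀ k, |ρ k / ω k| ≤ e k := fun k => by
    rw [abs_div, abs_of_pos (hω k), div_le_iff₀ (hω k), mul_comm]; exact hρ k
  have htω : ∀ n k, n ≤ k → |ω n * t k| ≤ e k := fun n k hnk => by
    rw [abs_mul, abs_of_pos (hω n), mul_comm]
    exact (mul_le_mul_of_nonneg_left (hmono hnk) (abs_nonneg _)).trans (ht k)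
  have hsω : ∀ n k, n ≤ k → |ω n * s k / ω k| ≤ e k := fun n k hnk => by
    rw [abs_div, abs_mul, abs_of_pos (hω n), abs_of_pos (hω k), div_le_iff₀ (hω k), mul_comm]
    exact mul_le_mul (hs k) (hmono hnk) (hω n).le (he₀ k)
  -- The unknown is (y, ω p). All four coefficients are then at most `e k`, two per component: hence
  -- the constant `2 * e k` and the bound 1/2 on the total mass.
  obtain ⟨x, M, hM, hx⟩ := exists_bounded_tail_fixed_point ((1, 0) : ℝ × ℝ)
    (fun n k z => (s k * z.1 - ρ k / ω k * z.2, ω n * t k * z.1 - ω n * s k / ω k * z.2))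
    (fun k => 2 * e k) (fun k => mul_nonneg zero_le_two (he₀ k)) (he.mul_left 2)
    (by rw [tsum_mul_left]; linarith) (fun n k => by simp) (fun n k hnk x y => by
      have h1 : |x.1 - y.1| ≤ ‖x - y‖ := norm_fst_le (x - y)
      have h2 : |x.2 - y.2| ≤ ‖x - y‖ := norm_snd_le (x - y)
      have key : ∀ c d : ℝ, |c| ≤ e k → |d| ≤ e k →
          |c * x.1 - d * x.2 - (c * y.1 - d * y.2)| ≤ 2 * e k * ‖x - y‖ := fun c d hc hd => by
        have h3 : |c * (x.1 - y.1)| ≤ e k * ‖x - y‖ := by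
          rw [abs_mul]; exact mul_le_mul hc h1 (abs_nonneg _) (he₀ k)
        have h4 : |d * (x.2 - y.2)| ≤ e k * ‖x - y‖ := by
          rw [abs_mul]; exact mul_le_mul hd h2 (abs_nonneg _) (he₀ k)
        calc _ = |c * (x.1 - y.1) - d * (x.2 - y.2)| := by ring_nf
          _ ≤ _ := abs_sub _ _
          _ ≤ _ := by linarith
      exact max_le (key _ _ (hs k) (hρω k)) (key _ _ (htω n k hnk) (hsω n k hnk)))
  have hy_le : ∀ k, |(x k).1| ≤ M := fun k => (norm_fst_le (x k)).trans (hM k)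
  have hq_le : ∀ k, |(x k).2| ≤ M := fun k => (norm_snd_le (x k)).trans (hM k)
  have hM₀ : 0 ≤ M := (abs_nonneg _).trans (hy_le 0)
  have hbound : ∀ c d k, |c| ≤ e k → |d| ≤ e k →
      ‖c * (x k).1 - d * (x k).2‖ ≤ e k * (2 * M) := fun c d k hc hd => by
    have h3 : |c * (x k).1| ≤ e k * M := by
      rw [abs_mul]; exact mul_le_mul hc (hy_le k) (abs_nonneg _) (he₀ k)
    have h4 : |d * (x k).2| ≤ e k * M := by
      rw [abs_mul]; exact mul_le_mul hd (hq_le k) (abs_nonneg _) (he₀ k)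
    exact (abs_sub _ _).trans (by linarith)
  set A : ℕ → ℝ := fun k => s k * (x k).1 - ρ k / ω k * (x k).2 with hA
  set B : ℕ → ℕ → ℝ := fun n k => ω n * t k * (x k).1 - ω n * s k / ω k * (x k).2 with hB
  -- `B n k` contains `ω n`, which changes with the start of the tail. Dividing it out yields terms
  -- independent of `n`, whose tails telescope.
  set D : ℕ → ℝ := fun k => t k * (x k).1 - s k / ω k * (x k).2 with hD
  have hsumA : Summable A := Summable.of_norm_bounded (he.mul_right (2 * M))
    fun k => hbound _ _ k (hs k) (hρω k)
  have hsumA' : ∀ n, Summable fun j => A (j + n) := fun n => (summable_nat_add_iff n).2 hsumA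
  have hsumB : ∀ n, Summable fun j => B n (j + n) := fun n =>
    Summable.of_norm_bounded (((summable_nat_add_iff n).2 he).mul_right (2 * M)) fun j =>
      hbound _ _ _ (htω n _ (Nat.le_add_left n j)) (hsω n _ (Nat.le_add_left n j))
  have hBD : ∀ n k, D k = (ω n)⁻¹ * B n k := fun n k => by
    have := (hω n).ne'
    simp only [hB, hD]; field_simp
  have hsumD : ∀ n, Summable fun j => D (j + n) := fun n => by
    simp only [hBD n]; exact (hsumB n).mul_left _
  have hsplit : ∀ n, x n = (1 + ∑' j, A (j + n), ∑' j, B n (j + n)) := fun n => by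
    have h := hx n
    have hprod : HasSum (fun j => (A (j + n), B n (j + n)))
        (∑' j, A (j + n), ∑' j, B n (j + n)) := (hsumA' n).hasSum.prodMk (hsumB n).hasSum
    rw [h]
    change (1, 0) + ∑' j, (A (j + n), B n (j + n)) = _
    rw [hprod.tsum_eq]; simp
  have hy : ∀ n, (x n).1 = 1 + ∑' j, A (j + n) := fun n => congrArg Prod.fst (hsplit n)
  have hq : ∀ n, (x n).2 / ω n = ∑' j, D (j + n) := fun n => by
    simp only [hBD n]
    rw [tsum_mul_left, div_eq_inv_mul]
    exact congrArg (fun z => (ω n)⁻¹ * z) (congrArg Prod.snd (hsplit n))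
  refine ⟨fun n => (x n).1, fun n => (x n).2 / ω n, M, fun k => ?_, fun k => ?_, ?_, fun k => ?_⟩
  · have h := tsum_tail_sub k (hsumA' k)
    have h1 := hy k
    have h2 := hy (k + 1)
    simp only [hA] at h h1 h2 ⊢
    have h3 : ρ k * ((x k).2 / ω k) = ρ k / ω k * (x k).2 := by ring
    linarith
  · have h := tsum_tail_sub k (hsumD k)
    have h1 := hq k
    have h2 := hq (k + 1)
    simp only [hD] at h h1 h2 ⊢
    have h3 : s k * ((x k).2 / ω k) = s k / ω k * (x k).2 := by ring
    linarith
  · have := (tendsto_sum_nat_add A).const_add 1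
    simp only [add_zero] at this
    exact this.congr fun n => (hy n).symm
  · rw [abs_div, abs_of_pos (hω k), div_mul_cancel₀ _ (hω k).ne']; exact hq_le k

/-! ### Convergence of series and growth of the power sums -/

theorem Ico_sum_eq_sub {E : Type*} [AddCommGroup E] [TopologicalSpace E] (n₀ : ℕ) (a : ℕ → E) :
    (fun N => ∑ k ∈ Finset.range N, a k - ∑ k ∈ Finset.range n₀, a k) =ᶠ[atTop]
      fun N => ∑ k ∈ Finset.Ico n₀ N, a k := by
  filter_upwards [eventually_ge_atTop n₀] with N hN
  rw [Finset.sum_Ico_eq_sub _ hN]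

theorem seriesConverges_of_summable {E : Type*} [AddCommGroup E] [TopologicalSpace E]
    [IsTopologicalAddGroup E] {a : ℕ → E} (n₀ : ℕ) (ha : Summable a) : SeriesConverges n₀ a :=
  ⟨_, (ha.hasSum.tendsto_sum_nat.sub_const _).congr' (Ico_sum_eq_sub n₀ a)⟩

theorem summable_of_seriesConverges {a : ℕ → ℝ} {n₀ : ℕ} (h : SeriesConverges n₀ a)
    (ha : ∀ n ≥ n₀, 0 ≤ a n) : Summable a := by
  obtain ⟨s, hs⟩ := h
  rw [← summable_nat_add_iff n₀]
  refine ((hasSum_iff_tendsto_nat_of_nonneg (fun i => ha _ (Nat.le_add_left n₀ i)) s).2 ?_).summable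
  refine (hs.comp (tendsto_add_atTop_nat n₀)).congr fun N => ?_
  rw [Function.comp, Finset.sum_Ico_eq_sum_range, Nat.add_sub_cancel]
  exact Finset.sum_congr rfl fun i _ => by rw [add_comm]

theorem not_summable_of_div_le {a : ℕ → ℝ} {c : ℝ} (hc : 0 < c)
    (h : ∀ᶠ n : ℕ in atTop, c / n ≤ a n) : ¬ Summable a := by
  intro ha
  have h1 : Summable fun n : ℕ => c / (n : ℝ) := ha.of_norm_bounded_eventually_nat <| by
    filter_upwards [h] with n hn
    rwa [Real.norm_of_nonneg (by positivity)]
  refine Real.not_summable_one_div_natCast ((h1.mul_left c⁻¹).congr fun n => ?_)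
  rw [← mul_div_assoc, inv_mul_cancel₀ hc.ne']

/-- The partial sums `∑_{1 ≤ k < n} k ^ (-α)`. -/
def powerSum (α : ℝ) (n : ℕ) : ℝ := ∑ k ∈ Finset.Ico 1 n, 1 / (k : ℝ) ^ α

theorem powerSum_succ (α : ℝ) {n : ℕ} (hn : 1 ≤ n) :
    powerSum α (n + 1) = powerSum α n + 1 / (n : ℝ) ^ α := Finset.sum_Ico_succ_top hn _

theorem powerSum_mono (α : ℝ) : Monotone (powerSum α) := fun m n h =>
  Finset.sum_le_sum_of_subset_of_nonneg (Finset.Ico_subset_Ico_right h)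
    fun k _ _ => by positivity

theorem powerSum_nonneg (α : ℝ) (n : ℕ) : 0 ≤ powerSum α n :=
  Finset.sum_nonneg fun k _ => by positivity

/-- Each of the n - 1 summands is at least n^(-α), and n - 1 ≥ n/2 from n = 2 on. -/
theorem le_powerSum {α : ℝ} (hα₀ : 0 ≤ α) {n : ℕ} (hn : 2 ≤ n) :
    (n : ℝ) ^ (1 - α) / 2 ≤ powerSum α n := by
  have hn0 : (0 : ℝ) < n := by positivity
  have h2 : (2 : ℝ) ≤ n := by exact_mod_cast hn
  have h : (Finset.Ico 1 n).card • (1 / (n : ℝ) ^ α) ≤ powerSum α n := by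
    refine Finset.card_nsmul_le_sum _ _ _ fun k hk => ?_
    rw [Finset.mem_Ico] at hk
    have hk0 : (0 : ℝ) < k := by exact_mod_cast hk.1
    exact one_div_le_one_div_of_le (by positivity)
      (Real.rpow_le_rpow hk0.le (by exact_mod_cast hk.2.le) hα₀)
  refine le_trans ?_ h
  rw [Nat.card_Ico, nsmul_eq_mul, Nat.cast_sub (by lia), Real.rpow_sub hn0, Real.rpow_one,
    Nat.cast_one, mul_one_div, div_right_comm]
  gcongr
  linarith

/-- Bernoulli's inequality with exponent 1 - α gives (1-α) m^(-α) ≤ m^(1-α) - (m-1)^(1-α), and the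
right side telescopes. -/
theorem powerSum_le {α : ℝ} (hα₀ : 0 ≤ α) (hα₁ : α < 1) (n : ℕ) :
    powerSum α n ≤ (n : ℝ) ^ (1 - α) / (1 - α) := by
  have h1 : 0 < 1 - α := by linarith
  -- The induction runs on the stronger bound for `powerSum α (n + 1)`, whose base case is 0 ≤ 0.
  refine (powerSum_mono α n.le_succ).trans ?_
  induction n with
  | zero => simp [powerSum, Real.zero_rpow h1.ne']
  | succ n ih =>
    have hm : (0 : ℝ) < (n + 1 : ℕ) := by positivity
    have hn : (n : ℝ) = (n + 1 : ℕ) * (1 + -((n + 1 : ℕ) : ℝ)⁻¹) := by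
      field_simp; push_cast; ring
    have hinv : ((n + 1 : ℕ) : ℝ)⁻¹ ≤ 1 := inv_le_one_of_one_le₀ (by norm_num)
    have hb := rpow_one_add_le_one_add_mul_self (s := -((n + 1 : ℕ) : ℝ)⁻¹) (p := 1 - α)
      (by linarith) h1.le (by linarith)
    have hpow : (n : ℝ) ^ (1 - α) ≤
        ((n + 1 : ℕ) : ℝ) ^ (1 - α) - (1 - α) * (1 / ((n + 1 : ℕ) : ℝ) ^ α) := by
      rw [hn, Real.mul_rpow hm.le (by linarith)]
      refine (mul_le_mul_of_nonneg_left hb (by positivity)).trans (le_of_eq ?_)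
      rw [Real.rpow_sub hm, Real.rpow_one]
      field_simp
      ring
    rw [powerSum_succ α n.succ_pos]
    refine (add_le_add_left ih _).trans ?_
    rw [div_add' _ _ _ h1.ne', div_le_div_iff_of_pos_right h1]
    linarith

theorem tendsto_powerSum {α : ℝ} (hα₀ : 0 ≤ α) (hα₁ : α < 1) :
    Tendsto (powerSum α) atTop atTop := by
  refine tendsto_atTop_mono' _ ?_
    (((tendsto_rpow_atTop (y := 1 - α) (by linarith)).comp tendsto_natCast_atTop_atTop).atTop_div_const
      (zero_lt_two' ℝ))
  filter_upwards [eventually_ge_atTop 2] with n hn using le_powerSum hα₀ hn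

/-! ### Tails of the alternating series -/

/-- The oscillating perturbation as a real sequence. -/
def osc (β : ℝ) (n : ℕ) : ℝ := (-1 : ℝ) ^ (n + 1) * (n : ℝ) ^ (-β)

theorem abs_osc (β : ℝ) (n : ℕ) : |osc β n| = (n : ℝ) ^ (-β) := by
  rw [osc, abs_mul, abs_pow, abs_neg, abs_one, one_pow, one_mul, abs_of_nonneg (by positivity)]

/-- The tails of the series `∑ (-1) ^ (n + 1) n ^ (-β)`. -/
theorem exists_osc_tail {β : ℝ} (hβ : 0 < β) : ∃ S : ℕ → ℝ, ∀ n ≥ 1,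
    |S n| ≤ (n : ℝ) ^ (-β) ∧ 0 ≤ osc β n * S n ∧ S n - S (n + 1) = osc β n ∧
    Tendsto (fun N => ∑ k ∈ Finset.Ico n N, osc β k) atTop (𝓝 (S n)) := by
  -- With the sign of its first term factored out, the tail is an alternating sum of decreasing
  -- terms, so its value `g` lies between 0 and that first term.
  have hex : ∀ n : ℕ, 1 ≤ n → ∃ g : ℝ, 0 ≤ g ∧ g ≤ (n : ℝ) ^ (-β) ∧
      Tendsto (fun N => ∑ k ∈ Finset.Ico n N, osc β k) atTop (𝓝 ((-1) ^ (n + 1) * g)) := by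
    intro n hn
    have hanti : Antitone fun i : ℕ => ((i + n : ℕ) : ℝ) ^ (-β) := fun i j hij =>
      Real.rpow_le_rpow_of_nonpos (by positivity) (by exact_mod_cast Nat.add_le_add_right hij n)
        (by linarith)
    have hzero : Tendsto (fun i : ℕ => ((i + n : ℕ) : ℝ) ^ (-β)) atTop (𝓝 0) :=
      (tendsto_rpow_neg_atTop hβ).comp
        (tendsto_natCast_atTop_atTop.comp (tendsto_add_atTop_nat n))
    obtain ⟨g, hg⟩ := hanti.tendsto_alternating_series_of_tendsto_zero hzero
    refine ⟨g, by simpa using hanti.alternating_series_le_tendsto hg 0,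
      by simpa using hanti.tendsto_le_alternating_series hg 0, ?_⟩
    rw [← tendsto_add_atTop_iff_nat n]
    refine (hg.const_mul ((-1) ^ (n + 1))).congr fun N => ?_
    rw [Finset.sum_Ico_eq_sum_range, Nat.add_sub_cancel, Finset.mul_sum]
    refine Finset.sum_congr rfl fun i _ => ?_
    rw [osc, add_comm i n]; ring
  choose! g hg₀ hg₁ hg using hex
  refine ⟨fun n => (-1) ^ (n + 1) * g n, fun n hn => ⟨?_, ?_, ?_, hg n hn⟩⟩
  · rw [abs_mul, abs_pow, abs_neg, abs_one, one_pow, one_mul, abs_of_nonneg (hg₀ n hn)]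
    exact hg₁ n hn
  · have h : osc β n * ((-1) ^ (n + 1) * g n) =
        ((-1 : ℝ) ^ (n + 1)) ^ 2 * ((n : ℝ) ^ (-β) * g n) := by rw [osc]; ring
    rw [h]
    have := hg₀ n hn
    positivity
  · have h1 := hg n hn
    have h2 := (hg (n + 1) (by lia)).const_add (osc β n)
    have h3 := tendsto_nhds_unique (h2.congr' ?_) h1
    · linarith
    · filter_upwards [eventually_gt_atTop n] with N hN
      rw [Finset.sum_eq_sum_Ico_succ_bot hN]

/-! ### Backward extension and reduction of order -/

/-- A solution near infinity extends backwards to a solution from index `1` on. -/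
theorem exists_solution_extension {r c : ℕ → ℝ} (hr : ∀ n ≥ 1, r n ≠ 0) {N : ℕ} (hN : 1 ≤ N)
    (y : ℕ → ℝ) (hy : IsSolution N r c y) :
    ∃ z, IsSolution 1 r c z ∧ ∀ n ≥ N, z n = y n := by
  induction N, hN using Nat.le_induction generalizing y with
  | base => exact ⟨y, hy, fun _ _ => rfl⟩
  | succ N hN ih =>
    have hrN := hr N hN
    obtain ⟨z, hz, hzy⟩ := ih (Function.update y N
      (y (N + 1) - (r (N + 1) * (y (N + 2) - y (N + 1)) - c (N + 1) * y (N + 1)) / r N)) (by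
        intro n hn
        rcases hn.eq_or_lt with rfl | hlt
        · rw [Function.update_self, Function.update_of_ne (by lia), Function.update_of_ne (by lia)]
          field_simp
          ring
        · rw [Function.update_of_ne (by lia), Function.update_of_ne (by lia),
            Function.update_of_ne (by lia)]
          exact hy n hlt)
    exact ⟨z, hz, fun n hn => by rw [hzy n (by lia), Function.update_of_ne (by lia)]⟩

/-- Reduction of order. -/
theorem isSolution_reduction {r c y : ℕ → ℝ} {N : ℕ} (hy : IsSolution N r c y)
    (hr : ∀ n ≥ N, r n ≠ 0) (hy₀ : ∀ n ≥ N, y n ≠ 0) :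
    IsSolution N r c fun n => y n * ∑ k ∈ Finset.Ico N n, 1 / (r k * y k * y (k + 1)) := by
  intro n hn
  have h := hy n hn
  have h0 := hr n hn
  have h1 := hr (n + 1) (by lia)
  have h2 := hy₀ n hn
  have h3 := hy₀ (n + 1) (by lia)
  have h4 := hy₀ (n + 2) (by lia)
  simp only
  rw [Finset.sum_Ico_succ_top (show N ≤ n + 1 by lia), Finset.sum_Ico_succ_top hn]
  generalize ∑ k ∈ Finset.Ico N n, 1 / (r k * y k * y (k + 1)) = R
  -- In `e1` and `e2` the quasi-difference of the product is that of `y` times the same sum, plus `1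
  -- / y (n + 1)`; this extra term cancels on subtraction.
  have e1 : r (n + 1) * (y (n + 2) * (R + 1 / (r n * y n * y (n + 1))
      + 1 / (r (n + 1) * y (n + 1) * y (n + 1 + 1))) - y (n + 1) * (R + 1 / (r n * y n * y (n + 1))))
      = r (n + 1) * (y (n + 2) - y (n + 1)) * (R + 1 / (r n * y n * y (n + 1))) + 1 / y (n + 1) := by
    field_simp; ring
  have e2 : r n * (y (n + 1) * (R + 1 / (r n * y n * y (n + 1))) - y n * R)
      = r n * (y (n + 1) - y n) * (R + 1 / (r n * y n * y (n + 1))) + 1 / y (n + 1) := by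
    field_simp; ring
  rw [e1, e2]
  linear_combination (R + 1 / (r n * y n * y (n + 1))) * h

/-! ### Principal pairs -/

theorem rPow_pos (α : ℝ) {n : ℕ} (hn : 1 ≤ n) : 0 < rPow α n :=
  Real.rpow_pos_of_pos (by exact_mod_cast hn) α

theorem powerSum_succ_sub (α : ℝ) {n : ℕ} (hn : 1 ≤ n) :
    powerSum α (n + 1) - powerSum α n = 1 / rPow α n := by
  rw [powerSum_succ α hn, add_sub_cancel_left, rPow]

theorem powerSum_pos (α : ℝ) {n : ℕ} (hn : 2 ≤ n) : 0 < powerSum α n :=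
  Finset.sum_pos (fun k hk => by
    have : (0 : ℝ) < k := by exact_mod_cast (Finset.mem_Ico.1 hk).1
    positivity) ⟨1, by simp; lia⟩

theorem isPrincipalPair_one_powerSum {α : ℝ} (hα₀ : 0 ≤ α) (hα₁ : α < 1) :
    IsPrincipalPair 1 (rPow α) (fun _ => 0) (fun _ => 1) (powerSum α) where
  solution_u := fun n _ => by simp
  solution_v := fun n hn => by
    have h0 := (rPow_pos α hn).ne'
    have h1 := (rPow_pos α (show 1 ≤ n + 1 by lia)).ne'
    rw [powerSum_succ_sub α hn, powerSum_succ_sub α (show 1 ≤ n + 1 by lia)]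
    field_simp
    ring
  casoratian := fun n hn => by
    have h0 := (rPow_pos α hn).ne'
    rw [mul_one, one_mul, powerSum_succ_sub α hn]
    field_simp
  ratio := by
    simpa [Pi.inv_def] using (tendsto_powerSum hα₀ hα₁).inv_tendsto_atTop
  eventually_pos := by
    -- Index 2, because `powerSum α 1` is an empty sum. The second series telescopes: its terms are
    -- 1/V_n - 1/V_{n+1}.
    refine ⟨2, by lia, fun n hn => ⟨one_pos, powerSum_pos α hn⟩, fun h => ?_, ?_⟩
    · have hs := summable_of_seriesConverges h fun n hn => by
        have := rPow_pos α (show 1 ≤ n by lia)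
        positivity
      refine not_summable_of_div_le one_pos ?_ hs
      filter_upwards [eventually_ge_atTop 1] with n hn
      have hn1 : (1 : ℝ) ≤ n := by exact_mod_cast hn
      rw [mul_one, mul_one]
      refine one_div_le_one_div_of_le (rPow_pos α hn) ?_
      simpa [rPow] using Real.rpow_le_rpow_of_exponent_le hn1 hα₁.le
    · refine ⟨1 / powerSum α 2 - 0, ?_⟩
      refine (((tendsto_powerSum hα₀ hα₁).inv_tendsto_atTop).const_sub (1 / powerSum α 2)).congr' ?_
      filter_upwards [eventually_ge_atTop 2] with N hN
      induction N, hN using Nat.le_induction with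
      | base => simp
      | succ N hN ih =>
        rw [Finset.sum_Ico_succ_top hN, ← ih]
        have h0 := (rPow_pos α (show 1 ≤ N by lia)).ne'
        have h1 := (powerSum_pos α hN).ne'
        have h2 := (powerSum_pos α (show 2 ≤ N + 1 by lia)).ne'
        have h3 := powerSum_succ_sub α (show 1 ≤ N by lia)
        have h4 : rPow α N * (powerSum α (N + 1) - powerSum α N) = 1 := by
          rw [h3]; field_simp
        simp only [Pi.inv_apply]
        field_simp
        linear_combination h4

/-- The flux r_n Δz_n is conserved, so the increments of z are a fixed multiple of 1/r_n, the
increment of `powerSum`. -/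
theorem isSolution_eq_affine {α : ℝ} {z : ℕ → ℝ} (hz : IsSolution 1 (rPow α) (fun _ => 0) z) :
    ∃ a c : ℝ, ∀ n ≥ 1, z n = a + c * powerSum α n := by
  refine ⟨z 1, rPow α 1 * (z 2 - z 1), fun n hn => ?_⟩
  have hconst : ∀ n ≥ 1, rPow α n * (z (n + 1) - z n) = rPow α 1 * (z 2 - z 1) := by
    intro n hn
    induction n, hn using Nat.le_induction with
    | base => rfl
    | succ n hn ih =>
      have := hz n hn
      simp only [zero_mul] at this
      rw [← ih]; linarith
  induction n, hn using Nat.le_induction with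
  | base => simp [powerSum]
  | succ n hn ih =>
    have h := hconst n hn
    have h0 := (rPow_pos α hn).ne'
    have h1 := powerSum_succ_sub α hn
    have h2 : powerSum α (n + 1) = powerSum α n + 1 / rPow α n := by linarith
    have h3 : z (n + 1) = z n + rPow α 1 * (z 2 - z 1) * (1 / rPow α n) := by
      rw [← h]; field_simp; ring
    rw [h2, h3, ih]
    ring

/-- All principal pairs arise from `(1, powerSum α)` in the obvious way. -/
theorem IsPrincipalPair.exists_eq {α : ℝ} (hα₀ : 0 ≤ α) (hα₁ : α < 1) {u v : ℕ → ℝ}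
    (h : IsPrincipalPair 1 (rPow α) (fun _ => 0) u v) :
    ∃ a b : ℝ, 0 < a ∧ ∀ n ≥ 1, u n = a ∧ v n = (powerSum α n + b) / a := by
  obtain ⟨a, c, hu⟩ := isSolution_eq_affine h.solution_u
  obtain ⟨b, d, hv⟩ := isSolution_eq_affine h.solution_v
  have hcas : d * a - c * b = 1 := by
    have h1 := h.casoratian 1 le_rfl
    have hr : rPow α 1 = 1 := by simp [rPow]
    have hV : powerSum α 2 = powerSum α 1 + 1 := by
      have := powerSum_succ_sub α le_rfl
      rw [hr] at this
      norm_num at this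
      linarith
    rw [hu 1 le_rfl, hv 1 le_rfl, hu 2 (by lia), hv 2 (by lia), hr, hV] at h1
    linear_combination h1
  have hinv := (tendsto_powerSum hα₀ hα₁).inv_tendsto_atTop
  have hlim2 : Tendsto (fun n => u n * (powerSum α n)⁻¹) atTop (𝓝 c) := by
    have h1 : Tendsto (fun n => a * (powerSum α n)⁻¹ + c) atTop (𝓝 (a * 0 + c)) :=
      (hinv.const_mul a).add_const c
    rw [mul_zero, zero_add] at h1
    refine h1.congr' ?_
    filter_upwards [eventually_ge_atTop 2] with n hn
    have := (powerSum_pos α hn).ne'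
    rw [hu n (by lia)]
    field_simp
  obtain ⟨n₁, hn₁, hpos, -⟩ := h.eventually_pos
  have hvlim : Tendsto (fun n => v n * (powerSum α n)⁻¹) atTop (𝓝 d) := by
    have h1 : Tendsto (fun n => b * (powerSum α n)⁻¹ + d) atTop (𝓝 (b * 0 + d)) :=
      (hinv.const_mul b).add_const d
    rw [mul_zero, zero_add] at h1
    refine h1.congr' ?_
    filter_upwards [eventually_ge_atTop 2] with n hn
    have := (powerSum_pos α hn).ne'
    rw [hv n (by lia)]
    field_simp
  -- u/V tends to c, but u/V = (u/v)(v/V) also tends to 0 · d.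
  have hc : c = 0 := by
    refine tendsto_nhds_unique hlim2 ?_
    have h1 := h.ratio.mul hvlim
    rw [zero_mul] at h1
    refine h1.congr' ?_
    filter_upwards [eventually_ge_atTop n₁] with n hn
    have := (hpos n hn).2.ne'
    field_simp
  subst hc
  have ha : 0 < a := by
    have := (hpos n₁ le_rfl).1
    rwa [hu n₁ hn₁, zero_mul, add_zero] at this
  -- With c = 0 the Casoratian gives d = 1/a, so v = b + V/a = (V + ab)/a.
  refine ⟨a, a * b, ha, fun n hn => ⟨by rw [hu n hn, zero_mul, add_zero], ?_⟩⟩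
  have hd : d = 1 / a := by field_simp; linarith
  rw [hv n hn, hd]
  field_simp
  ring

/-- Together with `eventually_le_mul_powerSum_add` this fixes the order of r_n u_n v_n as exactly n.
-/
theorem mul_powerSum_le {α : ℝ} (hα₀ : 0 ≤ α) (hα₁ : α < 1) (b : ℝ) {n : ℕ} (hn : 1 ≤ n) :
    rPow α n * (powerSum α n + b) ≤ (1 / (1 - α) + |b|) * n := by
  have hn1 : (1 : ℝ) ≤ n := by exact_mod_cast hn
  have hn0 : (0 : ℝ) < n := by linarith
  have h1 : rPow α n ≤ n := by
    simpa [rPow] using Real.rpow_le_rpow_of_exponent_le hn1 hα₁.le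
  have h2 : rPow α n * (n : ℝ) ^ (1 - α) = n := by
    rw [rPow, ← Real.rpow_add hn0]; simp
  have h3 := mul_le_mul_of_nonneg_left (powerSum_le hα₀ hα₁ n) (rPow_pos α hn).le
  rw [← mul_div_assoc, h2] at h3
  have h4 : rPow α n * b ≤ n * |b| :=
    (mul_le_mul_of_nonneg_left (le_abs_self b) (rPow_pos α hn).le).trans
      (mul_le_mul_of_nonneg_right h1 (abs_nonneg b))
  calc _ = rPow α n * powerSum α n + rPow α n * b := by ring
    _ ≤ n / (1 - α) + n * |b| := add_le_add h3 h4
    _ = _ := by ring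

theorem eventually_le_powerSum_add {α : ℝ} (hα₀ : 0 ≤ α) (hα₁ : α < 1) (b : ℝ) :
    ∀ᶠ n : ℕ in atTop, (n : ℝ) ^ (1 - α) / 4 ≤ powerSum α n + b := by
  filter_upwards [eventually_ge_atTop 2,
    (tendsto_powerSum hα₀ hα₁).eventually_ge_atTop (-2 * b)] with n hn hb
  have := le_powerSum hα₀ hn
  linarith

theorem eventually_le_mul_powerSum_add {α : ℝ} (hα₀ : 0 ≤ α) (hα₁ : α < 1) (b : ℝ) :
    ∀ᶠ n : ℕ in atTop, (n : ℝ) / 4 ≤ rPow α n * (powerSum α n + b) := by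
  filter_upwards [eventually_ge_atTop 1, eventually_le_powerSum_add hα₀ hα₁ b] with n hn hb
  have hn0 : (0 : ℝ) < n := by exact_mod_cast hn
  have h2 : rPow α n * (n : ℝ) ^ (1 - α) = n := by
    rw [rPow, ← Real.rpow_add hn0]; simp
  have h3 := mul_le_mul_of_nonneg_left hb (rPow_pos α hn).le
  rwa [← mul_div_assoc, h2] at h3

/-! ### Solvability for α + β > 1 -/

/-- The perturbed equation has a solution tending to `1` with rapidly decaying differences. -/
theorem exists_solution_tendsto_one {α β : ℝ} (hα₁ : α < 1) (hαβ : 1 < α + β) :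
    ∃ N ≥ 1, ∃ y : ℕ → ℝ, IsSolution N (rPow α) (osc β) y ∧ Tendsto y atTop (𝓝 1) ∧
      (fun n => y (n + 1) - y n) =O[atTop] fun n : ℕ => (n : ℝ) ^ (-(α + β)) := by
  have hβ : 0 < β := by linarith
  obtain ⟨S, hS⟩ := exists_osc_tail hβ
  have hsum : Summable fun n : ℕ => (n : ℝ) ^ (-(α + β)) := Real.summable_nat_rpow.2 (by linarith)
  obtain ⟨N, hN1, hN⟩ := ((eventually_ge_atTop 1).and ((tendsto_sum_nat_add
    fun n : ℕ => (n : ℝ) ^ (-(α + β))).eventually_lt_const (show (0 : ℝ) < 1 / 2 by norm_num))).exists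
  have hpos : ∀ k, 1 ≤ k + N := fun k => by lia
  have hcast : ∀ k, (0 : ℝ) < (k + N : ℕ) := fun k => by exact_mod_cast hpos k
  have hSle : ∀ n ≥ 1, |S (n + 1)| ≤ (n : ℝ) ^ (-β) := fun n hn =>
    (hS (n + 1) (by lia)).1.trans <| Real.rpow_le_rpow_of_nonpos (by exact_mod_cast hn)
      (by exact_mod_cast n.le_succ) (by linarith)
  have hr : ∀ k, 1 / rPow α (k + N) = ((k + N : ℕ) : ℝ) ^ (-α) := fun k => by
    rw [rPow, Real.rpow_neg (hcast k).le, one_div]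
  have hsk : ∀ k, |S (k + N + 1) / rPow α (k + N)| ≤ ((k + N : ℕ) : ℝ) ^ (-(α + β)) := fun k => by
    rw [div_eq_mul_one_div, hr, abs_mul, abs_of_pos (Real.rpow_pos_of_pos (hcast k) _), neg_add_rev,
      Real.rpow_add (hcast k)]
    exact mul_le_mul_of_nonneg_right (hSle _ (hpos k)) (Real.rpow_nonneg (hcast k).le _)
  -- For p_n = r_n Δy_n + S_{n+1} y_n the equation becomes Δp_n = S_{n+1} Δy_n, because σ_{n+1} =
  -- S_{n+1} - S_{n+2}. Eliminating Δy_n gives the coefficients S/r, 1/r, S²/r, balanced by the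
  -- weight n^β.
  obtain ⟨y, p, M, hy, hp, hlim, hM⟩ := exists_solution_of_small
    (fun k => S (k + N + 1) / rPow α (k + N)) (fun k => S (k + N + 1) ^ 2 / rPow α (k + N))
    (fun k => 1 / rPow α (k + N)) (fun k => ((k + N : ℕ) : ℝ) ^ β)
    (fun k => ((k + N : ℕ) : ℝ) ^ (-(α + β)))
    (fun k => Real.rpow_pos_of_pos (hcast k) _)
    (fun i j hij => Real.rpow_le_rpow (hcast i).le
      (by exact_mod_cast Nat.add_le_add_right hij N) hβ.le)
    ((summable_nat_add_iff N).2 hsum) hN hsk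
    (fun k => by
      rw [hr, ← Real.rpow_add (hcast k), abs_of_pos (Real.rpow_pos_of_pos (hcast k) _)]
      exact le_of_eq (by ring_nf))
    (fun k => by
      rw [pow_two, mul_div_assoc, abs_mul]
      have h1 : |S (k + N + 1)| * ((k + N : ℕ) : ℝ) ^ β ≤ 1 := by
        refine (mul_le_mul_of_nonneg_right (hSle _ (hpos k))
          (Real.rpow_nonneg (hcast k).le _)).trans (le_of_eq ?_)
        rw [← Real.rpow_add (hcast k)]; simp
      calc _ = (|S (k + N + 1)| * ((k + N : ℕ) : ℝ) ^ β) * |S (k + N + 1) / rPow α (k + N)| := by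
            ring
        _ ≤ 1 * ((k + N : ℕ) : ℝ) ^ (-(α + β)) :=
          mul_le_mul h1 (hsk k) (abs_nonneg _) zero_le_one
        _ = _ := one_mul _)
  have hdiff : ∀ k, y (k + 1) - y k = (p k - S (k + N + 1) * y k) / rPow α (k + N) := fun k => by
    rw [hy k]; ring
  refine ⟨N, hN1, fun n => y (n - N), ?_, ?_, ?_⟩
  · intro n hn
    obtain ⟨k, rfl⟩ := Nat.exists_eq_add_of_le' hn
    have e1 : k + N + 1 - N = k + 1 := by lia
    have e2 : k + N + 2 - N = k + 1 + 1 := by lia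
    simp only [Nat.add_sub_cancel, e1, e2]
    have h0 := (rPow_pos α (hpos k)).ne'
    have h1 := (rPow_pos α (hpos (k + 1))).ne'
    have d0 := hdiff k
    have d1 := hdiff (k + 1)
    have hpk := hp k
    have hσ := (hS (k + N + 1) (by lia)).2.2.1
    have e3 : k + 1 + N = k + N + 1 := by lia
    rw [e3] at d1 h1
    have d0' : rPow α (k + N) * (y (k + 1) - y k) = p k - S (k + N + 1) * y k := by
      rw [d0]; field_simp
    have d1' : rPow α (k + N + 1) * (y (k + 1 + 1) - y (k + 1)) =
        p (k + 1) - S (k + N + 1 + 1) * y (k + 1) := by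
      rw [d1]; field_simp
    rw [d0', d1', ← hσ]
    have hpk' : p (k + 1) - p k = S (k + N + 1) * (y (k + 1) - y k) := by
      rw [hpk, d0]; ring
    linear_combination hpk'
  · exact (tendsto_add_atTop_iff_nat N).1 (by simpa using hlim)
  · have hybd : ∀ᶠ n in atTop, |y (n - N)| ≤ 2 := by
      have h1 : Tendsto (fun n => y (n - N)) atTop (𝓝 1) :=
        (tendsto_add_atTop_iff_nat N).1 (by simpa using hlim)
      have h2 := h1.abs
      rw [abs_one] at h2
      filter_upwards [h2.eventually_lt_const one_lt_two] with n hn using hn.le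
    refine IsBigO.of_bound (M + 2) ?_
    filter_upwards [hybd, eventually_ge_atTop N] with n hn hNn
    obtain ⟨k, rfl⟩ := Nat.exists_eq_add_of_le' hNn
    rw [Nat.add_sub_cancel] at hn
    have e1 : k + N + 1 - N = k + 1 := by lia
    rw [Nat.add_sub_cancel, e1, hdiff, div_eq_mul_one_div, hr, norm_mul,
      Real.norm_of_nonneg (Real.rpow_nonneg (hcast k).le _),
      Real.norm_of_nonneg (Real.rpow_nonneg (hcast k).le _), neg_add_rev, Real.rpow_add (hcast k),
      ← mul_assoc]
    refine mul_le_mul_of_nonneg_right ?_ (Real.rpow_nonneg (hcast k).le _)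
    have h1 : |p k| ≤ M * ((k + N : ℕ) : ℝ) ^ (-β) := by
      rw [Real.rpow_neg (hcast k).le, ← div_eq_mul_inv,
        le_div_iff₀ (Real.rpow_pos_of_pos (hcast k) _)]
      exact hM k
    have h2 : |S (k + N + 1) * y k| ≤ ((k + N : ℕ) : ℝ) ^ (-β) * 2 := by
      rw [abs_mul]
      exact mul_le_mul (hSle _ (hpos k)) hn (abs_nonneg _) (Real.rpow_nonneg (hcast k).le _)
    exact (abs_sub _ _).trans (by linarith)

/-- A form of Stolz–Cesàro: f - g = o(g) is inherited by partial sums because those of g diverge,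
and the differing lower limits contribute only constants. -/
theorem tendsto_sum_Ico_div {f g : ℕ → ℝ} (hg : ∀ n, 0 ≤ g n) (hg₀ : ∀ᶠ n in atTop, g n ≠ 0)
    (hfg : Tendsto (fun n => f n / g n) atTop (𝓝 1)) (m N : ℕ)
    (htop : Tendsto (fun n => ∑ k ∈ Finset.Ico m n, g k) atTop atTop) :
    Tendsto (fun n => (∑ k ∈ Finset.Ico N n, f k) / ∑ k ∈ Finset.Ico m n, g k) atTop (𝓝 1) := by
  have hG := Ico_sum_eq_sub m g
  have htop' : Tendsto (fun n => ∑ k ∈ Finset.range n, g k) atTop atTop := by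
    refine (tendsto_atTop_add_const_right _ (∑ k ∈ Finset.range m, g k) htop).congr' ?_
    filter_upwards [hG] with n hn
    rw [← hn, sub_add_cancel]
  have hlo : (fun n => f n - g n) =o[atTop] g := by
    rw [isLittleO_iff_tendsto' (hg₀.mono fun n h1 h2 => absurd h2 h1)]
    have h1 := hfg.sub_const 1
    rw [sub_self] at h1
    refine h1.congr' ?_
    filter_upwards [hg₀] with n hn
    field_simp
  have hlo' := hlo.sum_range hg htop'
  have h1 : (fun n => ∑ k ∈ Finset.Ico N n, f k - ∑ k ∈ Finset.Ico m n, g k) =o[atTop]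
      fun n => ∑ k ∈ Finset.Ico m n, g k := by
    have hgg : (fun n => ∑ k ∈ Finset.range n, g k) =O[atTop]
        fun n => ∑ k ∈ Finset.Ico m n, g k := by
      have : (fun _ : ℕ => ∑ k ∈ Finset.range m, g k) =o[atTop]
          fun n => ∑ k ∈ Finset.Ico m n, g k :=
        isLittleO_const_left.2 (Or.inr (tendsto_norm_atTop_atTop.comp htop))
      refine ((isBigO_refl _ _).add this.isBigO).congr' ?_ EventuallyEq.rfl
      filter_upwards [hG] with n hn
      rw [← hn, sub_add_cancel]
    have h2 : (fun _ : ℕ => ∑ k ∈ Finset.range m, g k - ∑ k ∈ Finset.range N, f k) =o[atTop]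
        fun n => ∑ k ∈ Finset.Ico m n, g k :=
      isLittleO_const_left.2 (Or.inr (tendsto_norm_atTop_atTop.comp htop))
    refine ((hlo'.trans_isBigO hgg).add h2).congr' ?_ EventuallyEq.rfl
    filter_upwards [hG, Ico_sum_eq_sub N f] with n hn hn'
    rw [← hn, ← hn', Finset.sum_sub_distrib]
    ring
  have h3 := h1.tendsto_div_nhds_zero.add_const 1
  rw [zero_add] at h3
  refine h3.congr' ?_
  filter_upwards [htop.eventually_gt_atTop 0] with n hn
  rw [sub_div, div_self hn.ne', sub_add_cancel]

theorem isSolution_ofReal {α β : ℝ} {y : ℕ → ℝ} (hy : IsSolution 1 (rPow α) (osc β) y) (c : ℝ) :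
    IsSolution 1 (fun n => (rPow α n : ℂ)) (fun n => (((0 : ℝ)) : ℂ) + sigmaOsc β n)
      fun n => ((c * y n : ℝ) : ℂ) := by
  intro n hn
  have h : rPow α (n + 1) * (c * y (n + 2) - c * y (n + 1)) - rPow α n * (c * y (n + 1) - c * y n)
      = osc β (n + 1) * (c * y (n + 1)) := by linear_combination c * hy n hn
  have h' := congrArg (fun x : ℝ => (x : ℂ)) h
  simp only [Complex.ofReal_sub, Complex.ofReal_mul (rPow _ _), Complex.ofReal_mul (osc _ _)] at h'
  simp only [Complex.ofReal_zero, zero_add]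
  exact h'

theorem isLittleO_natCast_rpow {p q : ℝ} (h : p < q) :
    (fun n : ℕ => (n : ℝ) ^ p) =o[atTop] fun n : ℕ => (n : ℝ) ^ q := by
  have h1 := (tendsto_rpow_neg_atTop (sub_pos.2 h)).comp tendsto_natCast_atTop_atTop
  rw [isLittleO_iff_tendsto']
  · refine h1.congr' ?_
    filter_upwards [eventually_ge_atTop 1] with n hn
    have hn0 : (0 : ℝ) < n := by exact_mod_cast hn
    rw [Function.comp, ← Real.rpow_sub hn0, neg_sub]
  · filter_upwards [eventually_ge_atTop 1] with n hn h2
    have hn0 : (0 : ℝ) < n := by exact_mod_cast hn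
    exact absurd h2 (Real.rpow_pos_of_pos hn0 q).ne'

theorem linearIndependent_ofReal_pair {y w : ℕ → ℝ} {n₀ m : ℕ} (hm : n₀ ≤ m)
    (h : y m * w (m + 1) - y (m + 1) * w m ≠ 0) :
    LinearIndependent ℂ ![fun k : ℕ => (y (n₀ + k) : ℂ), fun k : ℕ => (w (n₀ + k) : ℂ)] := by
  obtain ⟨k, rfl⟩ := Nat.exists_eq_add_of_le hm
  have h' : (y (n₀ + k) * w (n₀ + k + 1) - y (n₀ + k + 1) * w (n₀ + k) : ℂ) ≠ 0 := by
    exact_mod_cast h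
  rw [LinearIndependent.pair_iff]
  intro s t hst
  have h0 : s * y (n₀ + k) + t * w (n₀ + k) = 0 := congrFun hst k
  have h1 : s * y (n₀ + k + 1) + t * w (n₀ + k + 1) = 0 := congrFun hst (k + 1)
  constructor
  · refine (mul_eq_zero.1 (?_ : s * _ = 0)).resolve_right h'
    linear_combination w (n₀ + k + 1) * h0 - w (n₀ + k) * h1
  · refine (mul_eq_zero.1 (?_ : t * _ = 0)).resolve_right h'
    linear_combination -y (n₀ + k + 1) * h0 + y (n₀ + k) * h1

/-- A second solution, independent of a given one tending to `1`. -/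
theorem exists_second_solution {α β : ℝ} (hα₀ : 0 ≤ α) (hα₁ : α < 1) {y : ℕ → ℝ}
    (hy : IsSolution 1 (rPow α) (osc β) y) (hlim : Tendsto y atTop (𝓝 1)) :
    ∃ w : ℕ → ℝ, IsSolution 1 (rPow α) (osc β) w ∧
      (∀ᶠ n in atTop, y n * w (n + 1) - y (n + 1) * w n = 1 / rPow α n) ∧
      Tendsto (fun n => w n / powerSum α n) atTop (𝓝 1) := by
  obtain ⟨N, hN1, hN⟩ : ∃ N ≥ 1, ∀ n ≥ N, y n ≠ 0 := by
    obtain ⟨N, hN⟩ := eventually_atTop.1 (hlim.eventually_ne one_ne_zero)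
    exact ⟨max N 1, le_max_right _ _, fun n hn => hN n ((le_max_left _ _).trans hn)⟩
  have hr : ∀ n ≥ 1, rPow α n ≠ 0 := fun n hn => (rPow_pos α hn).ne'
  -- Reduction of order needs `y` nonzero, hence starts at `N`; its summands are asymptotic to
  -- 1/k^α, as y → 1.
  obtain ⟨w, hw, hwy⟩ := exists_solution_extension hr hN1 _ (isSolution_reduction
    (fun n hn => hy n (hN1.trans hn)) (fun n hn => hr n (hN1.trans hn)) hN)
  refine ⟨w, hw, ?_, ?_⟩
  · filter_upwards [eventually_ge_atTop N] with n hn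
    have h1 := hN n hn
    have h2 := hN (n + 1) (by lia)
    have h3 := hr n (by lia)
    rw [hwy n hn, hwy (n + 1) (by lia), Finset.sum_Ico_succ_top hn]
    field_simp
    ring
  · have hlim1 : Tendsto (fun n => y (n + 1)) atTop (𝓝 1) := (tendsto_add_atTop_iff_nat 1).2 hlim
    have hprod := (hlim.mul hlim1).inv₀ (by norm_num)
    have h1 := tendsto_sum_Ico_div (f := fun k => 1 / (rPow α k * y k * y (k + 1)))
      (g := fun k => 1 / (k : ℝ) ^ α) (fun n => by positivity)
      (by
        filter_upwards [eventually_ge_atTop 1] with n hn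
        exact one_div_ne_zero (hr n hn))
      (by
        rw [one_mul, inv_one] at hprod
        refine hprod.congr' ?_
        filter_upwards [eventually_ge_atTop N] with n hn
        have h1 := hN n hn
        have h2 := hN (n + 1) (by lia)
        have h3 := hr n (by lia)
        rw [← rPow]
        field_simp) 1 N (tendsto_powerSum hα₀ hα₁)
    have h2 := hlim.mul h1
    rw [one_mul] at h2
    refine h2.congr' ?_
    filter_upwards [eventually_ge_atTop N] with n hn
    rw [hwy n hn, powerSum, mul_div_assoc]

theorem narrowSolvable_of_one_lt {α β : ℝ} (hα₀ : 0 ≤ α) (hα₁ : α < 1) (hαβ : 1 < α + β)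
    {u v : ℕ → ℝ} {a b : ℝ} (ha : 0 < a)
    (huv : ∀ n ≥ 1, u n = a ∧ v n = (powerSum α n + b) / a) :
    NarrowSolvable 1 (rPow α) (fun _ => 0) (sigmaOsc β) u v := by
  obtain ⟨N, hN1, y₀, hy₀, hlim₀, hO₀⟩ := exists_solution_tendsto_one hα₁ hαβ
  obtain ⟨y, hy, hyy⟩ := exists_solution_extension (fun n hn => (rPow_pos α hn).ne') hN1 y₀ hy₀
  have hlim : Tendsto y atTop (𝓝 1) := hlim₀.congr' <| by
    filter_upwards [eventually_ge_atTop N] with n hn using (hyy n hn).symm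
  have hO : (fun n => y (n + 1) - y n) =O[atTop] fun n : ℕ => (n : ℝ) ^ (-(α + β)) := by
    refine hO₀.congr' ?_ EventuallyEq.rfl
    filter_upwards [eventually_ge_atTop N] with n hn
    rw [hyy n hn, hyy (n + 1) (by lia)]
  obtain ⟨w, hw, hcas, hwlim⟩ := exists_second_solution hα₀ hα₁ hy hlim
  have hV := tendsto_powerSum hα₀ hα₁
  have hQ : Tendsto (fun n => powerSum α n + b) atTop atTop := tendsto_atTop_add_const_right _ b hV
  have hQpos := hQ.eventually_gt_atTop 0
  have hwQ : Tendsto (fun n => w n / (powerSum α n + b)) atTop (𝓝 1) := by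
    have h1 : Tendsto (fun n => powerSum α n / (powerSum α n + b)) atTop (𝓝 (1 - b * 0)) := by
      refine ((hQ.inv_tendsto_atTop.const_mul b).const_sub 1).congr' ?_
      filter_upwards [hQpos] with n hn
      simp only [Pi.inv_apply]
      field_simp
      ring
    have h2 := hwlim.mul h1
    simp only [mul_zero, sub_zero, mul_one] at h2
    refine h2.congr' ?_
    filter_upwards [hV.eventually_gt_atTop 0] with n hn
    field_simp
  set δ : ℕ → ℝ := fun n => 1 / (rPow α n * (powerSum α n + b)) with hδ
  have hδu : δ =ᶠ[atTop] fun n => 1 / (rPow α n * u n * v n) := by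
    filter_upwards [eventually_ge_atTop 1] with n hn
    rw [(huv n hn).1, (huv n hn).2]
    simp only [hδ]
    congr 1
    field_simp
  have hoδ : (fun n => y (n + 1) - y n) =o[atTop] δ := by
    have h1 : (fun n : ℕ => (n : ℝ) ^ (-(α + β))) =o[atTop] fun n : ℕ => (n : ℝ) ^ (-1 : ℝ) :=
      isLittleO_natCast_rpow (by linarith)
    have h2 : (fun n : ℕ => (n : ℝ) ^ (-1 : ℝ)) =O[atTop] δ := by
      refine IsBigO.of_bound (1 / (1 - α) + |b|) ?_
      filter_upwards [eventually_ge_atTop 1, hQpos] with n hn hQn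
      have hn0 : (0 : ℝ) < n := by exact_mod_cast hn
      have hrQ : 0 < rPow α n * (powerSum α n + b) := mul_pos (rPow_pos α hn) hQn
      rw [Real.rpow_neg_one, Real.norm_of_nonneg (by positivity),
        Real.norm_of_nonneg (by positivity), mul_one_div, le_div_iff₀ hrQ, inv_mul_le_iff₀ hn0,
        mul_comm (n : ℝ)]
      exact mul_powerSum_le hα₀ hα₁ b hn
    exact hO.trans_isLittleO (h1.trans_isBigO h2)
  have hyne := hlim.eventually_ne one_ne_zero
  have hwpos : ∀ᶠ n in atTop, w n ≠ 0 := by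
    filter_upwards [hwQ.eventually_ne one_ne_zero] with n hn h
    rw [h, zero_div] at hn
    exact hn rfl
  have hdiv : (fun n => y (n + 1) / y n - 1) =o[atTop] δ := by
    have h1 : (fun n => (y n)⁻¹) =O[atTop] fun _ => (1 : ℝ) := (hlim.inv₀ one_ne_zero).isBigO_one ℝ
    have h2 := hoδ.mul_isBigO h1
    refine h2.congr' ?_ (Eventually.of_forall fun n => mul_one _)
    filter_upwards [hyne] with n hn
    field_simp
  have hcast : ∀ x : ℕ → ℝ, (∀ᶠ n in atTop, x n ≠ 0) → ∀ c : ℝ, c ≠ 0 → ∀ᶠ n in atTop,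
      ((c * x (n + 1) : ℝ) : ℂ) / ((c * x n : ℝ) : ℂ) = ((x (n + 1) / x n : ℝ) : ℂ) :=
    fun x hx c hc => by
      filter_upwards [hx] with n hn
      rw [← Complex.ofReal_div, mul_div_mul_left _ _ hc]
  have hofReal : ∀ f : ℕ → ℝ, f =o[atTop] δ → (fun n => ((f n : ℝ) : ℂ)) =o[atTop] δ :=
    fun f hf => IsLittleO.of_norm_left (by simpa using hf.norm_left)
  refine ⟨fun n => ((a * y n : ℝ) : ℂ), fun n => ((a⁻¹ * w n : ℝ) : ℂ),
    ⟨isSolution_ofReal hy a, isSolution_ofReal hw a⁻¹, ?_⟩, ⟨?_, ?_, ?_, ?_⟩, ?_⟩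
  · obtain ⟨m, hm1, hm⟩ := ((eventually_ge_atTop 1).and hcas).exists
    refine linearIndependent_ofReal_pair (y := fun n => a * y n) (w := fun n => a⁻¹ * w n) hm1 ?_
    have h1 : a * y m * (a⁻¹ * w (m + 1)) - a * y (m + 1) * (a⁻¹ * w m) = 1 / rPow α m := by
      rw [← hm]; field_simp
    exact h1.trans_ne (one_div_ne_zero (rPow_pos α hm1).ne')
  · refine ((Complex.continuous_ofReal.tendsto 1).comp hlim).congr' ?_
    filter_upwards [eventually_ge_atTop 1] with n hn
    rw [(huv n hn).1, ← Complex.ofReal_div, mul_div_cancel_left₀ _ ha.ne', Function.comp]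
  · refine ((Complex.continuous_ofReal.tendsto 1).comp hwQ).congr' ?_
    filter_upwards [eventually_ge_atTop 1] with n hn
    rw [(huv n hn).2, ← Complex.ofReal_div, Function.comp]
    congr 1
    field_simp
  · refine (hofReal _ hdiv).congr' ?_ hδu
    filter_upwards [eventually_ge_atTop 1, hcast y hyne a ha.ne'] with n hn hc
    rw [hc, (huv n hn).1, (huv (n + 1) (by lia)).1, ← Complex.ofReal_div, div_self ha.ne',
      Complex.ofReal_sub]
  -- The Casoratian gives w_{n+1}/w_n = y_{n+1}/y_n + 1/(r_n y_n w_n), while v_{n+1}/v_n = 1 + δ_n.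
  -- Since y → 1 and w ~ V + b, the two differ by o(δ).
  · have h1 : (fun n => δ n * ((powerSum α n + b) / (y n * w n) - 1)) =o[atTop] δ := by
      have h2 : Tendsto (fun n => (powerSum α n + b) / (y n * w n) - 1) atTop (𝓝 0) := by
        have h3 := ((hlim.mul hwQ).inv₀ (by norm_num)).sub_const 1
        rw [one_mul, inv_one, sub_self] at h3
        refine h3.congr' ?_
        filter_upwards [hyne, hwpos, hQpos] with n h1 h2 h3
        field_simp
      simpa using (isBigO_refl δ atTop).mul_isLittleO ((isLittleO_one_iff ℝ).2 h2)
    refine (hofReal _ (hdiv.add h1)).congr' ?_ hδu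
    filter_upwards [eventually_ge_atTop 1, hcast w hwpos a⁻¹ (inv_ne_zero ha.ne'), hcas, hyne,
      hwpos, hQpos] with n hn hc hcs hyn hwn hQn
    have hr := (rPow_pos α hn).ne'
    rw [hc, (huv n hn).2, (huv (n + 1) (by lia)).2, ← Complex.ofReal_div, ← Complex.ofReal_sub]
    congr 1
    have e1 : (powerSum α (n + 1) + b) / a / ((powerSum α n + b) / a) = 1 + δ n := by
      have := powerSum_succ_sub α hn
      have h2 : powerSum α (n + 1) = powerSum α n + 1 / rPow α n := by linarith
      rw [h2]
      simp only [hδ]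
      field_simp
      ring
    have e2 : w (n + 1) / w n = y (n + 1) / y n + 1 / (rPow α n * y n * w n) := by
      have h2 : w (n + 1) = (1 / rPow α n + y (n + 1) * w n) / y n := by
        rw [← hcs]; field_simp; ring
      rw [h2]
      field_simp
      ring
    rw [e1, e2]
    simp only [hδ]
    field_simp
    ring
  · refine seriesConverges_of_summable 1 ?_
    have h1 : (fun n => rPow α n * (powerSum α (n + 1) + b)) =O[atTop] fun n : ℕ => (n : ℝ) := by
      refine IsBigO.of_bound ((1 / (1 - α) + |b|) * 2) ?_
      filter_upwards [eventually_ge_atTop 1, (tendsto_add_atTop_nat 1).eventually hQpos]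
        with n hn hQn
      have hn1 : (1 : ℝ) ≤ n := by exact_mod_cast hn
      have h1α : 0 < 1 - α := by linarith
      rw [Real.norm_of_nonneg (mul_nonneg (rPow_pos α hn).le hQn.le),
        Real.norm_of_nonneg (by linarith)]
      have h2 : rPow α n ≤ rPow α (n + 1) :=
        Real.rpow_le_rpow (by linarith) (by exact_mod_cast n.le_succ) hα₀
      refine (mul_le_mul_of_nonneg_right h2 hQn.le).trans
        ((mul_powerSum_le hα₀ hα₁ b n.succ_pos).trans ?_)
      rw [mul_assoc]
      refine mul_le_mul_of_nonneg_left ?_ (by positivity)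
      push_cast
      linarith
    -- The narrow series has terms O(n · n^(-2(α+β))), and 1 - 2(α+β) < -1.
    have h2 := h1.mul (hO.pow 2)
    refine summable_of_isBigO_nat (g := fun n : ℕ => (n : ℝ) ^ (1 - 2 * (α + β)))
      (Real.summable_nat_rpow.2 (by linarith)) (h2.congr' ?_ ?_)
    · filter_upwards [eventually_ge_atTop 1] with n hn
      rw [(huv n hn).1, (huv (n + 1) (by lia)).1, (huv (n + 1) (by lia)).2, ← Complex.ofReal_div,
        ← Complex.ofReal_div, mul_div_cancel_left₀ _ ha.ne', mul_div_cancel_left₀ _ ha.ne',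
        ← Complex.ofReal_sub, Complex.norm_real, Real.norm_eq_abs, sq_abs]
      field_simp
    · filter_upwards [eventually_ge_atTop 1] with n hn
      have hn0 : (0 : ℝ) < n := by exact_mod_cast hn
      rw [← Real.rpow_natCast, ← Real.rpow_mul hn0.le]
      nth_rewrite 1 [← Real.rpow_one (n : ℝ)]
      rw [← Real.rpow_add hn0]
      congr 1
      push_cast
      ring

/-! ### Necessity of α + β > 1 -/

theorem norm_sigmaOsc (β : ℝ) (n : ℕ) : ‖sigmaOsc β n‖ = (n : ℝ) ^ (-β) := by
  rw [← abs_osc, ← Real.norm_eq_abs, ← Complex.norm_real]; rfl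

/-- Put x_n = r_n (y_{n+1}/y_n - 1), which the ratio condition makes o(n^(α-1)). Dividing the
equation by y_{n+1} gives σ_{n+1} = x_{n+1} - x_n y_n/y_{n+1}, so σ_n = o(n^(α-1)). If α + β ≤ 1,
then |σ_n| ≥ n^(α-1), a contradiction. -/
theorem one_lt_of_solvable {α β : ℝ} (hα₀ : 0 ≤ α) (hα₁ : α < 1) {u v : ℕ → ℝ} {a b : ℝ}
    (ha : 0 < a) (huv : ∀ n ≥ 1, u n = a ∧ v n = (powerSum α n + b) / a)
    (h : Solvable 1 (rPow α) (fun _ => 0) (sigmaOsc β) u v) : 1 < α + β := by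
  obtain ⟨y, w, ⟨hy, -, -⟩, hA⟩ := h
  by_contra! hcon
  have hlim : Tendsto y atTop (𝓝 a) := by
    have h1 := hA.tendsto_u.mul_const (a : ℂ)
    rw [one_mul] at h1
    refine h1.congr' ?_
    filter_upwards [eventually_ge_atTop 1] with n hn
    rw [(huv n hn).1, div_mul_cancel₀ _ (Complex.ofReal_ne_zero.2 ha.ne')]
  have ha' : (a : ℂ) ≠ 0 := Complex.ofReal_ne_zero.2 ha.ne'
  have hyne := hlim.eventually_ne ha'
  have hx : (fun n => (rPow α n : ℂ) * (y (n + 1) / y n - 1)) =o[atTop]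
      fun n : ℕ => (n : ℝ) ^ (α - 1) := by
    have h1 : (fun n => y (n + 1) / y n - 1) =o[atTop] fun n : ℕ => (n : ℝ)⁻¹ := by
      refine (hA.ratio_u.congr' ?_ EventuallyEq.rfl).trans_isBigO (IsBigO.of_bound 4 ?_)
      · filter_upwards [eventually_ge_atTop 1] with n hn
        rw [(huv n hn).1, (huv (n + 1) (by lia)).1, div_self ha']
      · filter_upwards [eventually_ge_atTop 1, eventually_le_mul_powerSum_add hα₀ hα₁ b]
          with n hn hQ
        have hn0 : (0 : ℝ) < n := by exact_mod_cast hn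
        have e : rPow α n * u n * v n = rPow α n * (powerSum α n + b) := by
          rw [(huv n hn).1, (huv n hn).2]; field_simp
        have hpos : 0 < rPow α n * (powerSum α n + b) := by linarith
        rw [e, Real.norm_of_nonneg (by positivity), Real.norm_of_nonneg (by positivity),
          ← div_eq_mul_inv, div_le_div_iff₀ hpos hn0]
        linarith
    have h2 : (fun n => (rPow α n : ℂ)) =O[atTop] rPow α :=
      IsBigO.of_norm_left (by simpa using (isBigO_refl (rPow α) atTop).norm_left)
    refine (h2.mul_isLittleO h1).congr' EventuallyEq.rfl ?_
    filter_upwards [eventually_ge_atTop 1] with n hn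
    rw [rPow, Real.rpow_sub_one (by positivity), div_eq_mul_inv]
  have hx1 : (fun n => (rPow α (n + 1) : ℂ) * (y (n + 1 + 1) / y (n + 1) - 1)) =o[atTop]
      fun n : ℕ => ((n + 1 : ℕ) : ℝ) ^ (α - 1) := hx.comp_tendsto (tendsto_add_atTop_nat 1)
  have hx0 : (fun n => (rPow α n : ℂ) * (y (n + 1) / y n - 1) * (y n / y (n + 1))) =o[atTop]
      fun n : ℕ => ((n + 1 : ℕ) : ℝ) ^ (α - 1) := by
    have h1 : (fun n => y n / y (n + 1)) =O[atTop] fun _ => (1 : ℝ) :=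
      (hlim.div ((tendsto_add_atTop_iff_nat 1).2 hlim) ha').isBigO_one ℝ
    have h2 : (fun n : ℕ => (n : ℝ) ^ (α - 1) * 1) =O[atTop]
        fun n : ℕ => ((n + 1 : ℕ) : ℝ) ^ (α - 1) := by
      -- From n ≥ (n+1)/2 and the negative exponent α - 1.
      refine IsBigO.of_bound ((2 : ℝ)⁻¹ ^ (α - 1)) ?_
      filter_upwards [eventually_ge_atTop 1] with n hn
      have hn1 : (1 : ℝ) ≤ n := by exact_mod_cast hn
      rw [mul_one, Real.norm_of_nonneg (by positivity), Real.norm_of_nonneg (by positivity),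
        ← Real.mul_rpow (by positivity) (by positivity)]
      refine Real.rpow_le_rpow_of_nonpos (by positivity) ?_ (by linarith)
      push_cast
      linarith
    exact (hx.mul_isBigO h1).trans_isBigO h2
  have hσ : (fun n => sigmaOsc β (n + 1)) =o[atTop] fun n : ℕ => ((n + 1 : ℕ) : ℝ) ^ (α - 1) := by
    refine (hx1.sub hx0).congr' ?_ EventuallyEq.rfl
    filter_upwards [eventually_ge_atTop 1, hyne, (tendsto_add_atTop_nat 1).eventually hyne]
      with n hn h0 h1
    have h2 := hy n hn
    simp only [Complex.ofReal_zero, zero_add] at h2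
    field_simp
    linear_combination h2
  have hself : (fun n : ℕ => ((n + 1 : ℕ) : ℝ) ^ (α - 1)) =o[atTop]
      fun n : ℕ => ((n + 1 : ℕ) : ℝ) ^ (α - 1) := by
    refine IsBigO.trans_isLittleO (IsBigO.of_bound 1 ?_) hσ
    filter_upwards with n
    rw [norm_sigmaOsc, one_mul, Real.norm_of_nonneg (by positivity)]
    exact Real.rpow_le_rpow_of_exponent_le (by norm_num) (by linarith)
  refine isLittleO_irrefl (Eventually.frequently (Eventually.of_forall fun n => ?_)) hself
  exact (Real.rpow_pos_of_pos (by positivity) _).ne'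

/-! ### Behaviour of B, J and P -/

/-- The source of the threshold 3/2 - α: n^(-β) V_n has order n^(1-α-β), which is at least n^(-1/2).
Both divergence proofs rest on it. -/
theorem eventually_le_rpow_mul_powerSum_add {α β : ℝ} (hα₀ : 0 ≤ α) (hα₁ : α < 1) (b : ℝ)
    (hβ : β ≤ 3 / 2 - α) :
    ∀ᶠ n : ℕ in atTop, 1 / 16 / (n : ℝ) ≤ ((n : ℝ) ^ (-β) * (powerSum α n + b)) ^ 2 := by
  filter_upwards [eventually_ge_atTop 1, eventually_le_powerSum_add hα₀ hα₁ b] with n hn hQ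
  have hn1 : (1 : ℝ) ≤ n := by exact_mod_cast hn
  have hn0 : (0 : ℝ) < n := by linarith
  have h1 : (n : ℝ) ^ (-(1 / 2) : ℝ) / 4 ≤ (n : ℝ) ^ (-β) * (powerSum α n + b) := by
    refine le_trans ?_ (mul_le_mul_of_nonneg_left hQ (by positivity))
    rw [← mul_div_assoc, ← Real.rpow_add hn0]
    gcongr
    linarith
  refine le_trans (le_of_eq ?_) (pow_le_pow_left₀ (by positivity) h1 2)
  have h2 : ((n : ℝ) ^ (-(1 / 2) : ℝ)) ^ 2 = (n : ℝ)⁻¹ := by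
    rw [← Real.rpow_natCast, ← Real.rpow_mul hn0.le, ← Real.rpow_neg_one]
    norm_num
  rw [div_pow, h2]
  ring

theorem not_seriesConverges_BTerm {α β : ℝ} (hα₀ : 0 ≤ α) (hα₁ : α < 1) {u v : ℕ → ℝ} {a b : ℝ}
    (ha : 0 < a) (huv : ∀ n ≥ 1, u n = a ∧ v n = (powerSum α n + b) / a) (hβ : β ≤ 3 / 2 - α) :
    ¬ SeriesConverges 1 (BTerm (sigmaOsc β) u v) := by
  intro h
  refine not_summable_of_div_le (c := 1 / 16) (by norm_num) ?_
    (summable_of_seriesConverges h fun n _ => sq_nonneg _)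
  filter_upwards [eventually_ge_atTop 1, eventually_le_rpow_mul_powerSum_add hα₀ hα₁ b hβ]
    with n hn hb
  refine hb.trans (le_of_eq ?_)
  have e : JTerm (sigmaOsc β) u v n = ((osc β n * (powerSum α n + b) : ℝ) : ℂ) := by
    change ((osc β n : ℝ) : ℂ) * u n * v n = _
    rw [(huv n hn).1, (huv n hn).2, ← Complex.ofReal_mul, ← Complex.ofReal_mul]
    congr 1
    field_simp
  rw [BTerm, e, Complex.norm_real, Real.norm_eq_abs, sq_abs, mul_pow, mul_pow, ← sq_abs (osc β n),
    abs_osc]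

theorem seriesConverges_ofReal {n₀ : ℕ} {f : ℕ → ℝ} {F : ℕ → ℂ} (hf : SeriesConverges n₀ f)
    (h : ∀ n ≥ n₀, F n = (f n : ℂ)) : SeriesConverges n₀ F := by
  obtain ⟨s, hs⟩ := hf
  refine ⟨s, ((Complex.continuous_ofReal.tendsto s).comp hs).congr fun N => ?_⟩
  rw [Function.comp, Complex.ofReal_sum]
  exact Finset.sum_congr rfl fun k hk => (h k (Finset.mem_Ico.1 hk).1).symm

theorem sigmaTerm_eq {β a : ℝ} {u : ℕ → ℝ} {n : ℕ} (h : u n = a) :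
    sigmaTerm (sigmaOsc β) u n = ((osc β n * a ^ 2 : ℝ) : ℂ) := by
  change ((osc β n : ℝ) : ℂ) * (u n : ℂ) ^ 2 = _
  rw [h]; push_cast; rfl

/-- Summation by parts: the boundary term S_N (V_N + b) is O(N^(1-α-β)) and vanishes, and ∑
S_{k+1}/r_k converges absolutely. -/
theorem seriesConverges_JTerm {α β : ℝ} (hα₀ : 0 ≤ α) (hα₁ : α < 1) {u v : ℕ → ℝ} {a b : ℝ}
    (ha : 0 < a) (huv : ∀ n ≥ 1, u n = a ∧ v n = (powerSum α n + b) / a) (hαβ : 1 < α + β) :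
    SeriesConverges 1 (JTerm (sigmaOsc β) u v) := by
  have hβ : 0 < β := by linarith
  obtain ⟨S, hS⟩ := exists_osc_tail hβ
  refine seriesConverges_ofReal (f := fun n => osc β n * (powerSum α n + b)) ?_ fun n hn => ?_
  · have hparts : ∀ N ≥ 1, ∑ k ∈ Finset.Ico 1 N, osc β k * (powerSum α k + b) =
        S 1 * (powerSum α 1 + b) - S N * (powerSum α N + b) +
          ∑ k ∈ Finset.Ico 1 N, S (k + 1) * (1 / rPow α k) := by
      intro N hN
      induction N, hN using Nat.le_induction with
      | base => simp
      | succ N hN ih =>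
        have h1 := powerSum_succ_sub α hN
        have h2 : powerSum α (N + 1) = powerSum α N + 1 / rPow α N := by linarith
        rw [Finset.sum_Ico_succ_top hN, Finset.sum_Ico_succ_top hN, ih, h2, ← (hS N hN).2.2.1]
        ring
    have hsum : Summable fun k => S (k + 1) * (1 / rPow α k) := by
      refine Summable.of_norm_bounded_eventually_nat
        (Real.summable_nat_rpow.2 (show -(α + β) < -1 by linarith)) ?_
      filter_upwards [eventually_ge_atTop 1] with n hn
      have hn0 : (0 : ℝ) < n := by exact_mod_cast hn
      rw [norm_mul, Real.norm_of_nonneg (one_div_nonneg.2 (rPow_pos α hn).le), neg_add_rev,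
        Real.rpow_add hn0, rPow, one_div, ← Real.rpow_neg hn0.le]
      refine mul_le_mul_of_nonneg_right ((hS (n + 1) (by lia)).1.trans ?_) (by positivity)
      exact Real.rpow_le_rpow_of_nonpos hn0 (by exact_mod_cast n.le_succ) (by linarith)
    have hzero : Tendsto (fun n => S n * (powerSum α n + b)) atTop (𝓝 0) := by
      have h1 : Tendsto (fun n : ℕ => (1 / (1 - α) + |b|) * (n : ℝ) ^ (-(α + β - 1))) atTop
          (𝓝 ((1 / (1 - α) + |b|) * 0)) :=
        ((tendsto_rpow_neg_atTop (by linarith)).comp tendsto_natCast_atTop_atTop).const_mul _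
      rw [mul_zero] at h1
      refine squeeze_zero_norm' ?_ h1
      filter_upwards [eventually_ge_atTop 1] with n hn
      have hn1 : (1 : ℝ) ≤ n := by exact_mod_cast hn
      have hn0 : (0 : ℝ) < n := by linarith
      have h2 : ‖powerSum α n + b‖ ≤ (1 / (1 - α) + |b|) * (n : ℝ) ^ (1 - α) := by
        have h3 := powerSum_le hα₀ hα₁ n
        have h4 : |b| * 1 ≤ |b| * (n : ℝ) ^ (1 - α) :=
          mul_le_mul_of_nonneg_left (Real.one_le_rpow hn1 (by linarith)) (abs_nonneg b)
        calc ‖powerSum α n + b‖ ≤ |powerSum α n| + |b| := abs_add_le _ _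
          _ = powerSum α n + |b| * 1 := by rw [abs_of_nonneg (powerSum_nonneg α n), mul_one]
          _ ≤ (n : ℝ) ^ (1 - α) / (1 - α) + |b| * (n : ℝ) ^ (1 - α) := add_le_add h3 h4
          _ = _ := by ring
      rw [norm_mul]
      refine (mul_le_mul (hS n hn).1 h2 (norm_nonneg _) (by positivity)).trans (le_of_eq ?_)
      rw [mul_left_comm, ← Real.rpow_add hn0]
      congr 2
      ring
    obtain ⟨s, hs⟩ := seriesConverges_of_summable 1 hsum
    refine ⟨_, ((hzero.const_sub (S 1 * (powerSum α 1 + b))).add hs).congr' ?_⟩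
    filter_upwards [eventually_ge_atTop 1] with N hN using (hparts N hN).symm
  · change ((osc β n : ℝ) : ℂ) * u n * v n = _
    rw [(huv n hn).1, (huv n hn).2, ← Complex.ofReal_mul, ← Complex.ofReal_mul]
    congr 1
    field_simp

theorem seriesConverges_sigmaTerm {β a : ℝ} {u : ℕ → ℝ} (hβ : 0 < β) (hu : ∀ n ≥ 1, u n = a) :
    SeriesConverges 1 (sigmaTerm (sigmaOsc β) u) := by
  obtain ⟨S, hS⟩ := exists_osc_tail hβ
  refine seriesConverges_ofReal (f := fun n => osc β n * a ^ 2)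
    ⟨S 1 * a ^ 2, ((hS 1 le_rfl).2.2.2.mul_const (a ^ 2)).congr fun N => Finset.sum_mul _ _ _⟩
    fun n hn => sigmaTerm_eq (hu n hn)

/-- As S_n has the sign of σ_n, the terms equal (V_n + b)² n^(-β) |S_n| and cannot cancel. No lower
bound for a single |S_n| is needed: σ_n = S_n - S_{n+1} gives |S_n| + |S_{n+1}| ≥ n^(-β), so two
consecutive terms together dominate a multiple of 1/n. -/
theorem not_seriesConverges_PTerm {α β : ℝ} (hα₀ : 0 ≤ α) (hα₁ : α < 1) {u v : ℕ → ℝ} {a b : ℝ}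
    (ha : 0 < a) (huv : ∀ n ≥ 1, u n = a ∧ v n = (powerSum α n + b) / a) (hβ : 0 < β)
    (hβ' : β ≤ 3 / 2 - α) : ¬ SeriesConverges 1 (PTerm (sigmaOsc β) u v) := by
  obtain ⟨S, hS⟩ := exists_osc_tail hβ
  have hC : ∀ n ≥ 1, C (sigmaOsc β) u v n = (((powerSum α n + b) * S n : ℝ) : ℂ) := by
    intro n hn
    have h1 : Tendsto (fun N => ∑ k ∈ Finset.Ico n N, sigmaTerm (sigmaOsc β) u k) atTop
        (𝓝 ((S n * a ^ 2 : ℝ) : ℂ)) := by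
      refine ((Complex.continuous_ofReal.tendsto _).comp
        ((hS n hn).2.2.2.mul_const (a ^ 2))).congr fun N => ?_
      rw [Function.comp, Finset.sum_mul, Complex.ofReal_sum]
      exact Finset.sum_congr rfl fun k hk =>
        (sigmaTerm_eq (huv k (hn.trans (Finset.mem_Ico.1 hk).1)).1).symm
    rw [C, h1.limUnder_eq, (huv n hn).1, (huv n hn).2, ← Complex.ofReal_div, ← Complex.ofReal_mul]
    congr 1
    field_simp
  have hP : ∀ n ≥ 1, PTerm (sigmaOsc β) u v n =
      (powerSum α n + b) ^ 2 * ((n : ℝ) ^ (-β) * |S n|) := by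
    intro n hn
    have h1 : (n : ℝ) ^ (-β) * |S n| = osc β n * S n := by
      rw [← abs_osc, ← abs_mul, abs_of_nonneg (hS n hn).2.1]
    rw [PTerm, hC n hn, Complex.conj_ofReal, (huv n hn).1, (huv n hn).2, h1]
    change (((osc β n : ℝ) : ℂ) * _).re * _ * _ = _
    rw [← Complex.ofReal_mul, Complex.ofReal_re]
    field_simp
  intro h
  have hsum := summable_of_seriesConverges h fun n hn => by rw [hP n hn]; positivity
  -- The factor 2^(-β) comes from (n+1)^(-β) ≥ (2n)^(-β), used to give both terms of a pair a common
  -- weight.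
  refine not_summable_of_div_le (c := 2 ^ (-β) * (1 / 16)) (by positivity) ?_
    (hsum.add ((summable_nat_add_iff 1).2 hsum))
  filter_upwards [eventually_ge_atTop 1, eventually_le_rpow_mul_powerSum_add hα₀ hα₁ b hβ',
    (tendsto_powerSum hα₀ hα₁).eventually_ge_atTop (-b)] with n hn hb hQ
  have hn1 : (1 : ℝ) ≤ n := by exact_mod_cast hn
  rw [hP n hn, hP (n + 1) (by lia), mul_div_assoc]
  have hS1 : (n : ℝ) ^ (-β) ≤ |S n| + |S (n + 1)| := by
    rw [← abs_osc, ← (hS n hn).2.2.1]; exact abs_sub _ _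
  have hpow : (2 : ℝ) ^ (-β) * (n : ℝ) ^ (-β) ≤ ((n + 1 : ℕ) : ℝ) ^ (-β) := by
    rw [← Real.mul_rpow zero_le_two (by linarith)]
    refine Real.rpow_le_rpow_of_nonpos (by positivity) ?_ (by linarith)
    push_cast
    linarith
  have hpow' : ((n + 1 : ℕ) : ℝ) ^ (-β) ≤ (n : ℝ) ^ (-β) :=
    Real.rpow_le_rpow_of_nonpos (by positivity) (by exact_mod_cast n.le_succ) (by linarith)
  have hQ1 : (powerSum α n + b) ^ 2 ≤ (powerSum α (n + 1) + b) ^ 2 :=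
    pow_le_pow_left₀ (by linarith) (by linarith [powerSum_mono α n.le_succ]) 2
  calc 2 ^ (-β) * (1 / 16 / (n : ℝ))
      ≤ 2 ^ (-β) * ((n : ℝ) ^ (-β) * (powerSum α n + b)) ^ 2 :=
        mul_le_mul_of_nonneg_left hb (by positivity)
    _ = (powerSum α n + b) ^ 2 * (2 ^ (-β) * (n : ℝ) ^ (-β) * (n : ℝ) ^ (-β)) := by ring
    _ ≤ (powerSum α n + b) ^ 2 * (((n + 1 : ℕ) : ℝ) ^ (-β) * (|S n| + |S (n + 1)|)) := by
        gcongr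
    _ = (powerSum α n + b) ^ 2 * (((n + 1 : ℕ) : ℝ) ^ (-β) * |S n|) +
        (powerSum α n + b) ^ 2 * (((n + 1 : ℕ) : ℝ) ^ (-β) * |S (n + 1)|) := by ring
    _ ≤ _ := by gcongr

end HartmanWintner

end

theorem mainTheorem8 (α : ℝ) (hα₀ : 0 ≤ α) (hα₁ : α < 1) :
    -- the standard pair of solutions of the unperturbed equation
    HartmanWintner.IsPrincipalPair 1 (HartmanWintner.rPow α) (fun _ => 0)
      (fun _ => 1) (fun n => ∑ k ∈ Finset.Ico 1 n, 1 / (k : ℝ) ^ α) ∧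
    ∀ u v : ℕ → ℝ,
      HartmanWintner.IsPrincipalPair 1 (HartmanWintner.rPow α) (fun _ => 0) u v →
      ∀ β : ℝ,
        (HartmanWintner.Solvable 1 (HartmanWintner.rPow α) (fun _ => 0)
            (HartmanWintner.sigmaOsc β) u v ↔ (α + β > 1 ∧ β > 0)) ∧
        (β ≤ 3 / 2 - α →
          ¬ HartmanWintner.SeriesConverges 1
            (HartmanWintner.BTerm (HartmanWintner.sigmaOsc β) u v)) ∧
        (1 - α < β → β ≤ 3 / 2 - α →
          HartmanWintner.NarrowSolvable 1 (HartmanWintner.rPow α) (fun _ => 0)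
            (HartmanWintner.sigmaOsc β) u v ∧
          HartmanWintner.SeriesConverges 1
            (HartmanWintner.JTerm (HartmanWintner.sigmaOsc β) u v) ∧
          HartmanWintner.SeriesConverges 1
            (HartmanWintner.sigmaTerm (HartmanWintner.sigmaOsc β) u) ∧
          ¬ HartmanWintner.SeriesConverges 1
            (HartmanWintner.PTerm (HartmanWintner.sigmaOsc β) u v) ∧
          -- the criterion "narrow problem solvable iff J and P converge" fails
          ¬ (HartmanWintner.NarrowSolvable 1 (HartmanWintner.rPow α) (fun _ => 0)
              (HartmanWintner.sigmaOsc β) u v ↔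
            (HartmanWintner.SeriesConverges 1
                (HartmanWintner.JTerm (HartmanWintner.sigmaOsc β) u v) ∧
              HartmanWintner.SeriesConverges 1
                (HartmanWintner.PTerm (HartmanWintner.sigmaOsc β) u v)))) := by
  refine ⟨HartmanWintner.isPrincipalPair_one_powerSum hα₀ hα₁, fun u v huv β => ?_⟩
  obtain ⟨a, b, ha, heq⟩ := huv.exists_eq hα₀ hα₁
  have hnarrow := fun h : 1 < α + β =>
    HartmanWintner.narrowSolvable_of_one_lt hα₀ hα₁ h ha heq
  refine ⟨⟨fun h => ?_, fun h => ?_⟩,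
    HartmanWintner.not_seriesConverges_BTerm hα₀ hα₁ ha heq, fun h₁ h₂ => ?_⟩
  · have := HartmanWintner.one_lt_of_solvable hα₀ hα₁ ha heq h
    exact ⟨this, by linarith⟩
  · obtain ⟨y, w, hfss, hasymp, -⟩ := hnarrow h.1
    exact ⟨y, w, hfss, hasymp⟩
  · have hαβ : 1 < α + β := by linarith
    have hβ : 0 < β := by linarith
    have hP := HartmanWintner.not_seriesConverges_PTerm hα₀ hα₁ ha heq hβ h₂
    exact ⟨hnarrow hαβ, HartmanWintner.seriesConverges_JTerm hα₀ hα₁ ha heq hαβ,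
      HartmanWintner.seriesConverges_sigmaTerm hβ fun n hn => (heq n hn).1, hP,
      fun hiff => hP (hiff.1 (hnarrow hαβ)).2⟩
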